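/- **Conventions.** A language $L$ consists of relation symbols, each of some finite arity $\ge 1$, and unary function symbols, and $\Gamma_L$ is a group of permutations of $L$ preserving types and arities of symbols. A $\Gamma_L$-structure $\mathbf A$ consists of a vertex set $A$, a relation $R_{\mathbf A}\subseteq A^{n}$ for every $n$-ary relation symbol $R\in L$, and a function $F_{\mathbf A}\colon A\to\mathcal P(A)$ for every function symbol $F\in L$; it is finite if $A$ is finite. An embedding $f\colon\mathbf A\to\mathbf B$ is a pair $(f_L,f_A)$ with $f_L\in\Gamma_L$ and $f_A\colon A\to B$ injective such that $(x_1,\dots,x_n)\in R_{\mathbf A}\iff(f_A(x_1),\dots,f_A(x_n))\in f_L(R)_{\mathbf B}$ and $f_A(F_{\mathbf A}(x))=f_L(F)_{\mathbf B}(f_A(x))$ for all symbols and vertices. It is an isomorphism if $f_A$ is bijective; an automorphism is an isomorphism of a structure to itself; pairs are composed coordinatewise. A substructure of $\mathbf A$ is the structure induced on a set $S\subseteq A$ with $F_{\mathbf A}(x)\subseteq S$ for all $F\in L$ and $x\in S$. For $g\in\Gamma_L$, the relabelled structure $g\mathbf A$ has vertex set $A$ and $S_{g\mathbf A}=(g^{-1}S)_{\mathbf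 A}$ for every symbol $S\in L$; this is the action of $\Gamma_L$ by relabelling. A structure $\mathbf C$ is irreducible if there are no proper substructures with vertex sets $U_1,U_2\subsetneq C$ such that $U_1\cup U_2=C$ and no tuple in a relation of $\mathbf C$ contains both a vertex of $U_1\setminus U_2$ and a vertex of $U_2\setminus U_1$ (that is, $\mathbf C$ is not the free amalgamation of two proper substructures). A partial automorphism of $\mathbf A$ is an isomorphism $f=(f_L,f_A)$ between two substructures of $\mathbf A$. A triple $(f,g,h)$ of partial automorphisms is coherent if $\mathrm{Dom}(f)=\mathrm{Dom}(h)$, $\mathrm{Range}(f)=\mathrm{Dom}(g)$, $\mathrm{Range}(g)=\mathrm{Range}(h)$ and $h=g\circ f$ (also on symbols). A $\Gamma_L$-structure $\mathbf B$ is an irreducible structure faithful coherent EPPA-witness for $\mathbf A$ if there is an embedding $\psi\colon\mathbf A\to\mathbf B$ such that 1. there is a map $f\mapsto\hat f$ from the partial automorphisms of $\psi(\mathbf A)$ to the automorphisms of $\mathbf B$ such that $\hat f$ extends $f$ (with $\hat f_L=f_L$) for every $f$, and $\hat h=\hat g\circ\hat f$ for every coherent triple $(f,g,h)$; and 2. for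 every irreducible substructure $\mathbf C$ of $\mathbf B$ there is an automorphism $\theta$ of $\mathbf B$ with $\theta(C)\subseteq\psi(A)$. **Theorem.** Let $L$ be a language consisting of relation symbols and unary function symbols, equipped with a permutation group $\Gamma_L$, and let $\mathbf A$ be a finite $\Gamma_L$-structure. If $\mathbf A$ lies in a finite orbit of the action of $\Gamma_L$ by relabelling, then there is a finite $\Gamma_L$-structure $\mathbf B$ which is an irreducible structure faithful coherent EPPA-witness for $\mathbf A$. Consequently, if every finite $\Gamma_L$-structure lies in a finite orbit of the action of $\Gamma_L$ by relabelling, then the class of all finite $\Gamma_L$-structures has irreducible structure faithful coherent EPPA: every finite $\Gamma_L$-structure has a finite $\Gamma_L$-structure as an irreducible structure faithful coherent EPPA-witness. -/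

import Mathlib

universe u v w

namespace GammaEPPA

/-- Permutations of the symbols of a language that preserve types (function / relation) and
arities. A permutation group on the language is a subgroup `Γ` of this group. -/
abbrev LangPerm (L : FirstOrder.Language.{u, v}) : Type (max u v) :=
  (∀ n, Equiv.Perm (L.Functions n)) × (∀ n, Equiv.Perm (L.Relations n))

/-- A structure on the vertex set `A`: an `n`-ary function symbol is interpreted as a map from
`n`-tuples of vertices to *sets* of vertices, an `n`-ary relation symbol as a set of `n`-tuples. -/
@[ext]
structure Str (L : FirstOrder.Language.{u, v}) (A : Type w) where
  func : ∀ n : ℕ, L.Functions n → (Fin n → A) → Set A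
  rel : ∀ n : ℕ, L.Relations n → Set (Fin n → A)

variable {L : FirstOrder.Language.{u, v}} {A B : Type w}

/-- The pair consisting of `g` (on symbols) and `f` (on vertices) is an embedding. -/
structure IsEmbedding (g : LangPerm L) (f : A → B) (M : Str L A) (N : Str L B) : Prop where
  injective : Function.Injective f
  map_rel : ∀ (n : ℕ) (R : L.Relations n) (x : Fin n → A),
    x ∈ M.rel n R ↔ f ∘ x ∈ N.rel n (g.2 n R)
  map_func : ∀ (n : ℕ) (F : L.Functions n) (x : Fin n → A),
    f '' M.func n F x = N.func n (g.1 n F) (f ∘ x)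

/-- An embedding of `Γ`-structures: the permutation of the language is part of the data. -/
structure Emb (Γ : Subgroup (LangPerm L)) (M : Str L A) (N : Str L B) where
  lang : Γ
  toFun : A → B
  isEmbedding : IsEmbedding (lang : LangPerm L) toFun M N

/-- An isomorphism of `Γ`-structures: an embedding that is bijective on vertices. -/
structure Iso (Γ : Subgroup (LangPerm L)) (M : Str L A) (N : Str L B) where
  lang : Γ
  toEquiv : A ≃ B
  isEmbedding : IsEmbedding (lang : LangPerm L) toEquiv M N

/-- An automorphism of a `Γ`-structure. -/
abbrev Aut (Γ : Subgroup (LangPerm L)) (M : Str L A) : Type _ := Iso Γ M M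

/-- The action by relabelling: `g • M` is the image of `M` under `(g, id)`, so that a symbol `S`
is interpreted in `g • M` as `g⁻¹ S` is in `M`. -/
instance : MulAction (LangPerm L) (Str L A) where
  smul g M := ⟨fun n F => M.func n (g⁻¹.1 n F), fun n R => M.rel n (g⁻¹.2 n R)⟩
  one_smul _ := rfl
  mul_smul _ _ _ := rfl

/-- `S` is the vertex set of a substructure of `M`, i.e. `S` is closed under the functions. -/
def IsSubstructure (M : Str L A) (S : Set A) : Prop :=
  ∀ (n : ℕ) (F : L.Functions n) (x : Fin n → A), (∀ i, x i ∈ S) → M.func n F x ⊆ S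

/-- The structure induced by `M` on `S`. -/
def Str.induce (M : Str L A) (S : Set A) : Str L S where
  func n F x := {y : S | (y : A) ∈ M.func n F fun i => (x i : A)}
  rel n R := {x : Fin n → S | (fun i => (x i : A)) ∈ M.rel n R}

/-- `M` is the free amalgamation of its substructures on `U₁` and `U₂` (over their intersection,
with respect to the inclusions): the two cover `M`, and a tuple with vertices both in `U₁ \ U₂`
and in `U₂ \ U₁` is in no relation and has empty image under every function. -/
structure IsFreeAmalgamation (M : Str L A) (U₁ U₂ : Set A) : Prop where
  sub_left : IsSubstructure M U₁
  sub_right : IsSubstructure M U₂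
  cover : U₁ ∪ U₂ = Set.univ
  rel_free : ∀ (n : ℕ) (R : L.Relations n) (x : Fin n → A),
    (∃ i, x i ∈ U₁ \ U₂) → (∃ j, x j ∈ U₂ \ U₁) → x ∉ M.rel n R
  func_free : ∀ (n : ℕ) (F : L.Functions n) (x : Fin n → A),
    (∃ i, x i ∈ U₁ \ U₂) → (∃ j, x j ∈ U₂ \ U₁) → M.func n F x = ∅

/-- A structure is irreducible if it is not the free amalgamation of two proper substructures. -/
def IsIrreducible (M : Str L A) : Prop :=
  ¬ ∃ U₁ U₂ : Set A, U₁ ≠ Set.univ ∧ U₂ ≠ Set.univ ∧ IsFreeAmalgamation M U₁ U₂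

/-- A partial automorphism: an isomorphism between two substructures, including a permutation of
the language from `Γ`. -/
structure PartialAut (Γ : Subgroup (LangPerm L)) (M : Str L A) where
  dom : Set A
  ran : Set A
  dom_sub : IsSubstructure M dom
  ran_sub : IsSubstructure M ran
  iso : Iso Γ (M.induce dom) (M.induce ran)

/-- `(f, g, h)` is a coherent triple: the domains and ranges match and `h = g ∘ f`, both on
symbols and on vertices. -/
structure IsCoherentTriple {Γ : Subgroup (LangPerm L)} {M : Str L A}
    (f g h : PartialAut Γ M) : Prop where
  dom_eq : f.dom = h.dom
  mid_eq : f.ran = g.dom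
  ran_eq : g.ran = h.ran
  lang_eq : h.iso.lang = g.iso.lang * f.iso.lang
  map_eq : ∀ x : f.dom,
    (h.iso.toEquiv ⟨x, dom_eq ▸ x.2⟩ : A) =
      g.iso.toEquiv ⟨f.iso.toEquiv x, mid_eq ▸ (f.iso.toEquiv x).2⟩

/-- The structure `ψ(M)`, as a structure on the range of `ψ`. -/
abbrev Emb.image {Γ : Subgroup (LangPerm L)} {M : Str L A} {N : Str L B} (ψ : Emb Γ M N) :
    Str L (Set.range ψ.toFun) :=
  N.induce (Set.range ψ.toFun)

/-- The automorphism `θ` of `N` extends the partial automorphism `p` of `ψ(M)`, on symbols and on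
vertices. -/
def Extends {Γ : Subgroup (LangPerm L)} {M : Str L A} {N : Str L B} {ψ : Emb Γ M N}
    (θ : Aut Γ N) (p : PartialAut Γ ψ.image) : Prop :=
  θ.lang = p.iso.lang ∧
    ∀ x : p.dom, θ.toEquiv ((x : Set.range ψ.toFun) : B) =
      ((p.iso.toEquiv x : Set.range ψ.toFun) : B)

/-- Every partial automorphism of `ψ(M)` extends to an automorphism of `N`, and the extensions can
be chosen such that coherent triples go to coherent triples. -/
def IsCoherentEPPAEmb {Γ : Subgroup (LangPerm L)} {M : Str L A} {N : Str L B}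
    (ψ : Emb Γ M N) : Prop :=
  ∃ φ : PartialAut Γ ψ.image → Aut Γ N,
    (∀ p, Extends (φ p) p) ∧
    ∀ f g h, IsCoherentTriple f g h →
      (φ h).lang = (φ g).lang * (φ f).lang ∧
        ∀ x : B, (φ h).toEquiv x = (φ g).toEquiv ((φ f).toEquiv x)

/-- Every irreducible substructure of `N` is sent by some automorphism of `N` into `ψ(M)`. -/
def IsFaithfulEmb {Γ : Subgroup (LangPerm L)} {M : Str L A} {N : Str L B}
    (ψ : Emb Γ M N) : Prop :=
  ∀ C : Set B, IsSubstructure N C → IsIrreducible (N.induce C) →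
    ∃ θ : Aut Γ N, θ.toEquiv '' C ⊆ Set.range ψ.toFun

/-- `N` is an irreducible structure faithful coherent EPPA-witness for `M`. -/
def IsFaithfulCoherentEPPAWitness (Γ : Subgroup (LangPerm L)) (M : Str L A) (N : Str L B) : Prop :=
  ∃ ψ : Emb Γ M N, IsCoherentEPPAEmb ψ ∧ IsFaithfulEmb ψ

/-- The class `K` of structures has irreducible structure faithful coherent EPPA. -/
def HasFaithfulCoherentEPPA (Γ : Subgroup (LangPerm L)) (K : ∀ A : Type w, Str L A → Prop) : Prop :=
  ∀ (A : Type w) (M : Str L A), K A M →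
    ∃ (B : Type w) (N : Str L B), K B N ∧ IsFaithfulCoherentEPPAWitness Γ M N

/-- `M` lies in a finite orbit of the action of `Γ` by relabelling. -/
def InFiniteOrbit (Γ : Subgroup (LangPerm L)) (M : Str L A) : Prop :=
  (MulAction.orbit Γ M).Finite

end GammaEPPA

namespace GammaEPPA

open Equiv
open scoped Classical

variable {L : FirstOrder.Language.{u, v}} {A B : Type w}

/-! The witness is a union of copies of `M` moved by a group `H` of labelled permutations of a
finite set containing `A`. Two properties of `H` suffice for coherent EPPA (`Amalgam`):
structure-preserving partial maps of `A` extend coherently into `H`, and every partial map that `H`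
induces on `A` preserves the structure. By the second property, the union of the copies adds nothing
to `M` on `A`.

Such an `H` comes from valuations. Each vertex carries a bit for every set `S ⊆ A` and every
structure in the orbit of `M` under relabelling of symbols and vertices; this orbit is finite by
hypothesis. The bits at `S` sum over `S` to the truth value of "this structure agrees with `M` on
`S`". `H` consists of the permutations that preserve these sums. A partial map of `A` induced by `H`
therefore preserves agreement. Conversely, a partial map preserving agreement leaves enough freedom
to correct the bits, and conjugating by corrections that depend only on domain and range keeps the
extensions coherent.

Faithfulness needs sets that lie pairwise in copies of `A` to lie in one copy. The cover
(`cover_isConformal`) enforces this by pigeonhole: a tuple of `k + 2` vertices lying in no copy gets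
`k + 1` colours, and vertices sharing a copy must get different ones.

For functions, a witness vertex remembers the image of its closure, so that copies meeting in a
vertex also share its closure. In an irreducible substructure any two vertices share a copy
(`exists_common_copy`), and conformality finishes the argument. -/

/-- `f` restricted to `D` preserves the relations, the graphs of the functions and the sizes of
the function values, up to the relabelling `g`. The set `D` need not be a substructure. -/
structure PreservesOn (M : Str L A) (D : Set A) (f : A → A) (g : LangPerm L) : Prop where
  rel : ∀ (n : ℕ) (R : L.Relations n) (x : Fin n → A), (∀ i, x i ∈ D) →
    (x ∈ M.rel n R ↔ f ∘ x ∈ M.rel n (g.2 n R))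
  func : ∀ (n : ℕ) (F : L.Functions n) (x : Fin n → A), (∀ i, x i ∈ D) → ∀ y ∈ D,
    (y ∈ M.func n F x ↔ f y ∈ M.func n (g.1 n F) (f ∘ x))
  card : ∀ (n : ℕ) (F : L.Functions n) (x : Fin n → A), (∀ i, x i ∈ D) →
    (M.func n F x).ncard = (M.func n (g.1 n F) (f ∘ x)).ncard

/-- A set `B` containing `A`, with a group `H` of permutations (labelled by `Γ`) that induces on
`A` exactly the partial maps satisfying `PreservesOn`, and a coherent choice `φ` of extensions. -/
structure Amalgam (Γ : Subgroup (LangPerm L)) (M : Str L A) (B : Type w) where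
  H : Subgroup (Perm B × Γ)
  ψ : A → B
  ψ_injective : Function.Injective ψ
  φ : ∀ D E : Set A, (D ≃ E) → Γ → Perm B × Γ
  φ_snd : ∀ (D E : Set A) (f : D ≃ E) (γ : Γ), (φ D E f γ).2 = γ
  φ_trans : ∀ (D E F : Set A) (f : D ≃ E) (g : E ≃ F) (γ δ : Γ),
    φ D F (f.trans g) (δ * γ) = φ E F g δ * φ D E f γ
  φ_mem : ∀ (D E : Set A) (f : D ≃ E) (γ : Γ) (s : A → A), (∀ x : D, s x = f x) →
    PreservesOn M D s γ → φ D E f γ ∈ H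
  φ_apply : ∀ (D E : Set A) (f : D ≃ E) (γ : Γ) (s : A → A), (∀ x : D, s x = f x) →
    PreservesOn M D s γ → ∀ x : D, (φ D E f γ).1 (ψ x) = ψ (f x)
  preserves : ∀ h ∈ H, ∀ (D : Set A) (f : A → A), (∀ x ∈ D, h.1 (ψ x) = ψ (f x)) →
    PreservesOn M D f h.2

/-! ### Coherent extension of partial permutations -/

theorem card_compl_eq_of_equiv [Finite A] {D E : Set A} (f : D ≃ E) :
    Nat.card ↥Dᶜ = Nat.card ↥Eᶜ := by
  have h : D.ncard = E.ncard := Nat.card_congr f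
  have h1 := Set.ncard_add_ncard_compl D
  have h2 := Set.ncard_add_ncard_compl E
  change Dᶜ.ncard = Eᶜ.ncard
  omega

/-- Extend a bijection between two subsets of a finite set to a permutation, matching the
complements along fixed enumerations. -/
noncomputable def extendPerm [Finite A] {D E : Set A} (f : D ≃ E) : Perm A :=
  (Equiv.Set.sumCompl D).symm.trans <|
    (Equiv.sumCongr f ((Finite.equivFin ↥Dᶜ).trans
      ((finCongr (card_compl_eq_of_equiv f)).trans (Finite.equivFin ↥Eᶜ).symm))).trans
      (Equiv.Set.sumCompl E)

theorem extendPerm_apply [Finite A] {D E : Set A} (f : D ≃ E) (x : D) :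
    extendPerm f x = f x := by
  simp [extendPerm]

/-- The enumeration of the complement of `E` is used once as a target and once as a source, so it
cancels. -/
theorem extendPerm_trans [Finite A] {D E F : Set A} (f : D ≃ E) (g : E ≃ F) :
    extendPerm (f.trans g) = extendPerm g * extendPerm f := by
  ext x
  by_cases hx : x ∈ D
  · simp [extendPerm, Equiv.Set.sumCompl_symm_apply_of_mem hx]
  · simp only [extendPerm, Equiv.Set.sumCompl_symm_apply_of_notMem hx, Equiv.trans_apply,
      Equiv.sumCongr_apply, Sum.map_inr, Equiv.Set.sumCompl_apply_inr, Perm.mul_apply,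
      Equiv.Set.sumCompl_symm_apply_compl]
    change _ = ((Finite.equivFin ↥Fᶜ).symm (finCongr (card_compl_eq_of_equiv g)
      (Finite.equivFin ↥Eᶜ ((Finite.equivFin ↥Eᶜ).symm (finCongr (card_compl_eq_of_equiv f)
        (Finite.equivFin ↥Dᶜ ⟨x, hx⟩))))) : A)
    rw [Equiv.apply_symm_apply]
    rfl

theorem extendPerm_mem_iff [Finite A] {D E : Set A} (f : D ≃ E) (x : A) :
    extendPerm f x ∈ E ↔ x ∈ D := by
  constructor
  · intro h
    have h1 := extendPerm_apply f (f.symm ⟨_, h⟩)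
    rw [Equiv.apply_symm_apply] at h1
    have h2 := (extendPerm f).injective h1
    exact h2 ▸ (f.symm ⟨_, h⟩).2
  · intro h
    rw [extendPerm_apply f ⟨x, h⟩]
    exact (f ⟨x, h⟩).2

theorem exists_perm_comp_eq {I X : Type*} [Finite X] (c d : I → X) (hc : Function.Injective c)
    (hd : Function.Injective d) : ∃ τ : Perm X, ∀ i, τ (c i) = d i := by
  refine ⟨extendPerm ((Equiv.ofInjective c hc).symm.trans (Equiv.ofInjective d hd)), fun i => ?_⟩
  rw [extendPerm_apply ((Equiv.ofInjective c hc).symm.trans (Equiv.ofInjective d hd))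
    (⟨c i, i, rfl⟩ : Set.range c)]
  have : (⟨c i, i, rfl⟩ : Set.range c) = Equiv.ofInjective c hc i := rfl
  rw [this]
  simp

/-! ### Relabelling both symbols and vertices -/

/-- The action on structures by relabelling the vertices and the symbols. -/
instance relabelAction (Γ : Subgroup (LangPerm L)) : MulAction (Perm A × Γ) (Str L A) where
  smul g M := ⟨fun n F x => g.1 '' M.func n ((g.2 : LangPerm L)⁻¹.1 n F) (g.1.symm ∘ x),
    fun n R => {x | g.1.symm ∘ x ∈ M.rel n ((g.2 : LangPerm L)⁻¹.2 n R)}⟩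
  one_smul M := by
    refine Str.ext ?_ ?_
    · funext n F x
      exact Set.image_id _
    · rfl
  mul_smul g h M := by
    refine Str.ext ?_ ?_
    · funext n F x
      exact Set.image_comp g.1 h.1 _
    · rfl

theorem mem_relabel_rel {Γ : Subgroup (LangPerm L)} (g : Perm A × Γ) (M : Str L A) (n : ℕ)
    (R : L.Relations n) (x : Fin n → A) :
    x ∈ (g • M).rel n R ↔ g.1.symm ∘ x ∈ M.rel n ((g.2 : LangPerm L)⁻¹.2 n R) := Iff.rfl

theorem relabel_func {Γ : Subgroup (LangPerm L)} (g : Perm A × Γ) (M : Str L A) (n : ℕ)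
    (F : L.Functions n) (x : Fin n → A) :
    (g • M).func n F x = g.1 '' M.func n ((g.2 : LangPerm L)⁻¹.1 n F) (g.1.symm ∘ x) := rfl

/-- Two structures on the same vertex set agree on `S`, up to the parts of the function values
outside of `S`, where only the sizes have to agree. -/
structure AgreeOn (S : Set A) (M N : Str L A) : Prop where
  rel : ∀ (n : ℕ) (R : L.Relations n) (x : Fin n → A), (∀ i, x i ∈ S) →
    (x ∈ M.rel n R ↔ x ∈ N.rel n R)
  func : ∀ (n : ℕ) (F : L.Functions n) (x : Fin n → A), (∀ i, x i ∈ S) → ∀ y ∈ S,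
    (y ∈ M.func n F x ↔ y ∈ N.func n F x)
  card : ∀ (n : ℕ) (F : L.Functions n) (x : Fin n → A), (∀ i, x i ∈ S) →
    (M.func n F x).ncard = (N.func n F x).ncard

theorem AgreeOn.refl (S : Set A) (M : Str L A) : AgreeOn S M M :=
  ⟨fun _ _ _ _ => Iff.rfl, fun _ _ _ _ _ _ => Iff.rfl, fun _ _ _ _ => rfl⟩

theorem AgreeOn.symm {S : Set A} {M N : Str L A} (h : AgreeOn S M N) : AgreeOn S N M :=
  ⟨fun n R x hx => (h.rel n R x hx).symm, fun n F x hx y hy => (h.func n F x hx y hy).symm,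
    fun n F x hx => (h.card n F x hx).symm⟩

theorem AgreeOn.trans {S : Set A} {M N K : Str L A} (h : AgreeOn S M N) (k : AgreeOn S N K) :
    AgreeOn S M K :=
  ⟨fun n R x hx => (h.rel n R x hx).trans (k.rel n R x hx),
    fun n F x hx y hy => (h.func n F x hx y hy).trans (k.func n F x hx y hy),
    fun n F x hx => (h.card n F x hx).trans (k.card n F x hx)⟩

theorem AgreeOn.relabel {Γ : Subgroup (LangPerm L)} {S : Set A} {M N : Str L A}
    (g : Perm A × Γ) (h : AgreeOn (g.1 ⁻¹' S) M N) : AgreeOn S (g • M) (g • N) := by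
  have key : ∀ (n : ℕ) (x : Fin n → A), (∀ i, x i ∈ S) →
      ∀ i, (g.1.symm ∘ x) i ∈ g.1 ⁻¹' S := fun n x hx i => by simpa using hx i
  refine ⟨fun n R x hx => h.rel n _ _ (key n x hx), fun n F x hx y hy => ?_, fun n F x hx => ?_⟩
  · rw [relabel_func, relabel_func, Equiv.image_eq_preimage_symm, Equiv.image_eq_preimage_symm]
    exact h.func n _ _ (key n x hx) _ (by simpa using hy)
  · rw [relabel_func, relabel_func, Set.ncard_image_of_injective _ g.1.injective,
      Set.ncard_image_of_injective _ g.1.injective]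
    exact h.card n _ _ (key n x hx)

theorem preservesOn_congr {M : Str L A} {D : Set A} {f f' : A → A} {g : LangPerm L}
    (hf : ∀ x ∈ D, f x = f' x) (h : PreservesOn M D f g) : PreservesOn M D f' g := by
  have key : ∀ (n : ℕ) (x : Fin n → A), (∀ i, x i ∈ D) → f ∘ x = f' ∘ x :=
    fun n x hx => funext fun i => hf _ (hx i)
  refine ⟨fun n R x hx => ?_, fun n F x hx y hy => ?_, fun n F x hx => ?_⟩
  · rw [← key n x hx]; exact h.rel n R x hx
  · rw [← key n x hx, ← hf y hy]; exact h.func n F x hx y hy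
  · rw [← key n x hx]; exact h.card n F x hx

/-- This turns a condition on a map into a condition on the structure `g • M`, which can serve as an
index of the valuations. -/
theorem preservesOn_iff_agreeOn {Γ : Subgroup (LangPerm L)} {M : Str L A} {S : Set A}
    (g : Perm A × Γ) : PreservesOn M (g.1 ⁻¹' S) g.1 g.2 ↔ AgreeOn S (g • M) M := by
  constructor
  · intro h
    have key : ∀ (n : ℕ) (x : Fin n → A), (∀ i, x i ∈ S) →
      ∀ i, (g.1.symm ∘ x) i ∈ g.1 ⁻¹' S := fun n x hx i => by simpa using hx i
    have e : ∀ (n : ℕ) (x : Fin n → A), g.1 ∘ g.1.symm ∘ x = x := fun n x => by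
      funext i; simp
    refine ⟨fun n R x hx => ?_, fun n F x hx y hy => ?_, fun n F x hx => ?_⟩
    · have := h.rel n ((g.2 : LangPerm L)⁻¹.2 n R) _ (key n x hx)
      rw [e] at this
      simpa [mem_relabel_rel] using this
    · have := h.func n ((g.2 : LangPerm L)⁻¹.1 n F) _ (key n x hx) (g.1.symm y) (by simpa using hy)
      rw [e] at this
      rw [relabel_func, Equiv.image_eq_preimage_symm]
      simpa using this
    · have := h.card n ((g.2 : LangPerm L)⁻¹.1 n F) _ (key n x hx)
      rw [e] at this
      rw [relabel_func, Set.ncard_image_of_injective _ g.1.injective]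
      simpa using this
  · intro h
    have key : ∀ (n : ℕ) (x : Fin n → A), (∀ i, x i ∈ g.1 ⁻¹' S) →
      ∀ i, (g.1 ∘ x) i ∈ S := fun n x hx i => hx i
    have e : ∀ (n : ℕ) (x : Fin n → A), g.1.symm ∘ g.1 ∘ x = x := fun n x => by
      funext i; simp
    refine ⟨fun n R x hx => ?_, fun n F x hx y hy => ?_, fun n F x hx => ?_⟩
    · have := h.rel n ((g.2 : LangPerm L).2 n R) _ (key n x hx)
      rw [mem_relabel_rel, e] at this
      simpa using this
    · have := h.func n ((g.2 : LangPerm L).1 n F) _ (key n x hx) (g.1 y) hy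
      rw [relabel_func, Equiv.image_eq_preimage_symm, e] at this
      simpa using this
    · have := h.card n ((g.2 : LangPerm L).1 n F) _ (key n x hx)
      rw [relabel_func, Set.ncard_image_of_injective _ g.1.injective, e] at this
      simpa using this

theorem finite_orbit_relabel [Finite A] {Γ : Subgroup (LangPerm L)} {M : Str L A}
    (h : InFiniteOrbit Γ M) : (MulAction.orbit (Perm A × Γ) M).Finite := by
  have : MulAction.orbit (Perm A × Γ) M ⊆
      Set.image2 (fun (σ : Perm A) (N : Str L A) => ((σ, 1) : Perm A × Γ) • N) Set.univ
        (MulAction.orbit Γ M) := by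
    rintro _ ⟨g, rfl⟩
    refine ⟨g.1, trivial, g.2 • M, ⟨g.2, rfl⟩, ?_⟩
    rfl
  exact (Set.Finite.image2 _ Set.finite_univ h).subset this

/-! ### Valuations: extending partial maps that preserve relations -/

/-- Vertices of the valuation construction: a vertex of `A` with a value for every set of vertices
and every index in `X`. -/
abbrev Val (A X : Type w) : Type w := A × (Set A → X → ZMod 2)

namespace Val

variable {X : Type w}

/-- The permutation of valuations induced by a permutation of `A` and a permutation of `X`. -/
def core (σ : Perm A) (τ : Perm X) : Perm (Val A X) where
  toFun b := (σ b.1, fun S m => b.2 (σ ⁻¹' S) (τ.symm m))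
  invFun b := (σ.symm b.1, fun S m => b.2 (σ.symm ⁻¹' S) (τ m))
  left_inv b := by
    ext <;> simp [← Set.preimage_comp]
  right_inv b := by
    ext <;> simp [← Set.preimage_comp]

theorem core_mul (σ σ' : Perm A) (τ τ' : Perm X) :
    core (σ * σ') (τ * τ') = core σ τ * core σ' τ' := rfl

/-- Translation of all valuations by `u`. -/
def translate (u : Set A → A → X → ZMod 2) : Perm (Val A X) where
  toFun b := (b.1, fun S m => b.2 S m + u S b.1 m)
  invFun b := (b.1, fun S m => b.2 S m - u S b.1 m)
  left_inv b := by ext <;> simp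
  right_inv b := by ext <;> simp

/-- The total value, at the set `S`, of a section `c` of the projection to `A`. -/
noncomputable def sectionSum [Fintype A] (c : A → Val A X) (S : Set A) (m : X) : ZMod 2 :=
  ∑ x, if x ∈ S then (c x).2 S m else 0

/-- The permutations of `Val A X` which cover a permutation of `A` and preserve all sums of
sections, up to the action on the index set `X`. -/
def sumPreserving [Fintype A] (Γ : Type*) [Group Γ] [MulAction (Perm A × Γ) X] :
    Subgroup (Perm (Val A X) × Γ) where
  carrier := {h | ∃ σ : Perm A, (∀ b, (h.1 b).1 = σ b.1) ∧
    ∀ c : A → Val A X, (∀ x, (c x).1 = x) → ∀ S m,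
      sectionSum (fun x => h.1 (c (σ.symm x))) S m =
        sectionSum c (σ ⁻¹' S) ((σ, h.2)⁻¹ • m)}
  one_mem' := by
    refine ⟨1, fun b => rfl, fun c hc S m => ?_⟩
    have : (((1 : Perm A), (1 : Γ))⁻¹ • m : X) = m := by
      rw [← Prod.one_eq_mk, inv_one, one_smul]
    change sectionSum c S m = sectionSum c S (((1 : Perm A), (1 : Γ))⁻¹ • m)
    rw [this]
  mul_mem' := by
    rintro h k ⟨σ, hσ, hs⟩ ⟨τ, kτ, ks⟩
    refine ⟨σ * τ, fun b => ?_, fun c hc S m => ?_⟩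
    · change (h.1 (k.1 b)).1 = _
      rw [hσ, kτ]; rfl
    · have h1 := hs (fun x => k.1 (c (τ.symm x))) (fun x => by rw [kτ, hc]; simp) S m
      have h2 := ks c hc (σ ⁻¹' S) ((σ, h.2)⁻¹ • m)
      refine (h1.trans h2).trans ?_
      rw [← mul_smul, ← mul_inv_rev]
      rfl
  inv_mem' := by
    rintro h ⟨σ, hσ, hs⟩
    have hi : ∀ b, (h.1.symm b).1 = σ.symm b.1 := fun b => by
      rw [Equiv.eq_symm_apply, ← hσ]; simp
    refine ⟨σ⁻¹, hi, fun c hc S m => ?_⟩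
    -- The sum condition for `h` is applied to the section that `h` carries to `c`.
    have h1 := hs (fun x => h.1.symm (c (σ x))) (fun x => by rw [hi, hc]; simp) (σ.symm ⁻¹' S)
      ((σ, h.2) • m)
    rw [inv_smul_smul, ← Set.preimage_comp] at h1
    simp only [Equiv.apply_symm_apply, Equiv.symm_comp_self,
      Set.preimage_id] at h1
    have h2 : (σ⁻¹, h⁻¹.2)⁻¹ = (σ, h.2) := by ext <;> simp
    rw [h2]
    exact h1.symm

/-- The distinguished element of a nonempty set. -/
def IsHub (S : Set A) (x : A) : Prop := ∃ h : S.Nonempty, h.some = x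

theorem sum_isHub [Fintype A] {S : Set A} (hS : S.Nonempty) (t : ZMod 2) :
    ∑ x, (if IsHub S x then t else 0) = t := by
  have : ∀ x, IsHub S x ↔ hS.some = x := fun x => ⟨fun ⟨_, h⟩ => h, fun h => ⟨hS, h⟩⟩
  simp [this]

theorem IsHub.mem {S : Set A} {x : A} (h : IsHub S x) : x ∈ S := by
  obtain ⟨h, rfl⟩ := h
  exact h.some_mem

/-- The values at a set `S` are supported on one element of `S`, and their total tells whether the
structure with index `m` agrees with the given one on `S`. -/
noncomputable def base (r : Set A → X → Prop) (S : Set A) (x : A) (m : X) : ZMod 2 :=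
  if IsHub S x then (if r S m then 1 else 0) else 0

/-- A function agreeing with `base` on `D`, with vanishing sums over the sets that are not subsets
of `D`. -/
noncomputable def gauge [Fintype A] (r : Set A → X → Prop) (D S : Set A) (x : A) (m : X) :
    ZMod 2 :=
  if x ∈ D then base r S x m
  else if IsHub (S \ D) x then - ∑ z, (if z ∈ D then base r S z m else 0) else 0

theorem base_of_notMem (r : Set A → X → Prop) {S : Set A} {x : A} (hx : x ∉ S) (m : X) :
    base r S x m = 0 := if_neg fun h => hx h.mem

theorem sum_base [Fintype A] (r : Set A → X → Prop) {S : Set A} (hS : S.Nonempty) (m : X) :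
    ∑ x, (if x ∈ S then base r S x m else 0) = if r S m then 1 else 0 := by
  rw [← sum_isHub hS (if r S m then 1 else 0)]
  refine Finset.sum_congr rfl fun x _ => ?_
  split_ifs with h h' h' h'
  all_goals simp_all [base]
  exact absurd h'.mem h

theorem sum_gauge_of_subset [Fintype A] (r : Set A → X → Prop) {D S : Set A} (h : S ⊆ D) (m : X) :
    ∑ x, (if x ∈ S then gauge r D S x m else 0) = ∑ x, if x ∈ S then base r S x m else 0 := by
  refine Finset.sum_congr rfl fun x _ => ?_
  by_cases hx : x ∈ S
  · simp [hx, gauge, h hx]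
  · simp [hx]

/-- Some vertex of `S` lies outside `D`, and the hub of `S \ D` absorbs the negative of everything
contributed by `D`. -/
theorem sum_gauge_of_not_subset [Fintype A] (r : Set A → X → Prop) {D S : Set A} (h : ¬ S ⊆ D)
    (m : X) : ∑ x, (if x ∈ S then gauge r D S x m else 0) = 0 := by
  have hne : (S \ D).Nonempty := Set.sdiff_nonempty.2 h
  have key : ∀ x, (if x ∈ S then gauge r D S x m else 0) =
      (if x ∈ D then base r S x m else 0) +
      (if IsHub (S \ D) x then - ∑ z, (if z ∈ D then base r S z m else 0) else 0) := by
    intro x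
    by_cases hD : x ∈ D
    · have : ¬ IsHub (S \ D) x := fun h => h.mem.2 hD
      by_cases hS : x ∈ S
      · simp [gauge, hD, hS, this]
      · simp [hD, hS, this, base_of_notMem r hS]
    · by_cases hS : x ∈ S
      · simp [gauge, hD, hS]
      · have : ¬ IsHub (S \ D) x := fun h => hS h.mem.1
        simp [hD, hS, this]
  simp_rw [key]
  rw [Finset.sum_add_distrib, sum_isHub hne]
  exact add_neg_cancel _

end Val

/-- An amalgam obtained from valuations indexed by a finite set of structures that contains `M`
and is closed under relabelling. -/
noncomputable def valuationAmalgam [Fintype A] (hR : IsEmpty (L.Relations 0))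
    (hF : IsEmpty (L.Functions 0)) (Γ : Subgroup (LangPerm L)) (M : Str L A)
    (X : Type w) [MulAction (Perm A × Γ) X] (str : X → Str L A)
    (hstr : ∀ (g : Perm A × Γ) (m : X), str (g • m) = g • str m) (m₀ : X) (hm₀ : str m₀ = M) :
    Amalgam Γ M (Val A X) where
  H := Val.sumPreserving Γ
  ψ x := (x, fun S m => Val.base (fun S m => AgreeOn S (str m) M) S x m)
  ψ_injective x y h := congrArg Prod.fst h
  -- Translation by the gauge of `D` takes `(x, 0)` to `ψ x` for `x ∈ D`. As the gauge depends on
  -- `D` alone, the inner translations cancel in compositions.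
  φ D E f γ :=
    (Val.translate (Val.gauge (fun S m => AgreeOn S (str m) M) E) *
      Val.core (extendPerm f) (MulAction.toPerm (extendPerm f, γ)) *
      (Val.translate (Val.gauge (fun S m => AgreeOn S (str m) M) D))⁻¹, γ)
  φ_snd _ _ _ _ := rfl
  φ_trans D E F f g γ δ := by
    refine Prod.ext ?_ rfl
    have : (MulAction.toPerm (extendPerm (f.trans g), δ * γ) : Perm X) =
        MulAction.toPerm (extendPerm g, δ) * MulAction.toPerm (extendPerm f, γ) := by
      ext m
      simp [extendPerm_trans, ← mul_smul]
    simp only [Prod.fst_mul]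
    rw [this, extendPerm_trans, Val.core_mul]
    group
  φ_mem D E f γ s hs hP := by
    set σ := extendPerm f with hσ
    set r : Set A → X → Prop := fun S m => AgreeOn S (str m) M with hr
    have hsub : ∀ S : Set A, σ ⁻¹' S ⊆ D ↔ S ⊆ E := by
      intro S
      constructor
      · intro h x hx
        have := h (show σ.symm x ∈ σ ⁻¹' S by simpa using hx)
        rw [← extendPerm_mem_iff f] at this
        simpa [← hσ] using this
      · intro h x hx
        exact (extendPerm_mem_iff f x).1 (h hx)
    -- Since `f` preserves `M`, the structures `(σ, γ) • M` and `M` agree on subsets of `E`;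
    -- agreement with `M` thus transports along `(σ, γ)`.
    have hagree : ∀ S : Set A, S ⊆ E → ∀ m : X, r (σ ⁻¹' S) ((σ, γ)⁻¹ • m) ↔ r S m := by
      intro S hS m
      have h0 : AgreeOn S ((σ, γ) • M) M := by
        rw [← preservesOn_iff_agreeOn]
        have h1 : PreservesOn M D σ γ :=
          preservesOn_congr (fun x hx => (hs ⟨x, hx⟩).trans (extendPerm_apply f ⟨x, hx⟩).symm) hP
        have h2 := (hsub S).2 hS
        exact ⟨fun n R x hx => h1.rel n R x fun i => h2 (hx i),
          fun n F x hx y hy => h1.func n F x (fun i => h2 (hx i)) y (h2 hy),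
          fun n F x hx => h1.card n F x fun i => h2 (hx i)⟩
      constructor
      · intro h
        have h1 : AgreeOn S ((σ, γ) • str ((σ, γ)⁻¹ • m)) ((σ, γ) • M) := AgreeOn.relabel (σ, γ) h
        rw [hstr, smul_inv_smul] at h1
        exact h1.trans h0
      · intro h
        have h1 : AgreeOn S (str m) ((σ, γ) • M) := AgreeOn.trans h h0.symm
        have h2 : AgreeOn (σ ⁻¹' S) ((σ, γ)⁻¹ • str m) ((σ, γ)⁻¹ • ((σ, γ) • M)) := by
          apply AgreeOn.relabel
          rw [← Set.preimage_comp]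
          simpa using h1
        rw [inv_smul_smul, ← hstr] at h2
        exact h2
    refine ⟨σ, fun b => rfl, fun c hc S m => ?_⟩
    have e : ∀ x, ((Val.translate (Val.gauge r E) *
        Val.core σ (MulAction.toPerm (σ, γ)) * (Val.translate (Val.gauge r D))⁻¹ : Perm (Val A X))
        (c (σ.symm x))).2 S m = (c (σ.symm x)).2 (σ ⁻¹' S) ((σ, γ)⁻¹ • m)
          - Val.gauge r D (σ ⁻¹' S) (σ.symm x) ((σ, γ)⁻¹ • m) + Val.gauge r E S x m := by
      intro x
      change (c (σ.symm x)).2 (σ ⁻¹' S) ((σ, γ)⁻¹ • m)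
          - Val.gauge r D (σ ⁻¹' S) (c (σ.symm x)).1 ((σ, γ)⁻¹ • m)
          + Val.gauge r E S (σ (c (σ.symm x)).1) m = _
      rw [hc, Equiv.apply_symm_apply]
    -- The total removed over `σ ⁻¹' S` equals the total added over `S`: both vanish unless `S ⊆ E`,
    -- and otherwise both record agreement with `M`.
    have hgauge : ∑ x, (if x ∈ σ ⁻¹' S then
        Val.gauge r D (σ ⁻¹' S) x ((σ, γ)⁻¹ • m) else 0) =
        ∑ x, (if x ∈ S then Val.gauge r E S x m else 0) := by
      by_cases hS : S ⊆ E
      · rw [Val.sum_gauge_of_subset r hS, Val.sum_gauge_of_subset r ((hsub S).2 hS)]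
        rcases S.eq_empty_or_nonempty with rfl | hne
        · simp
        · have hne' : (σ ⁻¹' S).Nonempty := by
            obtain ⟨x, hx⟩ := hne
            exact ⟨σ.symm x, by simpa using hx⟩
          rw [Val.sum_base r hne, Val.sum_base r hne']
          simp only [hagree S hS m]
      · rw [Val.sum_gauge_of_not_subset r hS,
          Val.sum_gauge_of_not_subset r (fun h => hS ((hsub S).1 h))]
    unfold Val.sectionSum
    rw [← Equiv.sum_comp σ]
    have e2 : ∀ x, (if σ x ∈ S then ((Val.translate (Val.gauge r E) *
        Val.core σ (MulAction.toPerm (σ, γ)) * (Val.translate (Val.gauge r D))⁻¹ : Perm (Val A X))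
        (c (σ.symm (σ x)))).2 S m else 0) =
        (if x ∈ σ ⁻¹' S then (c x).2 (σ ⁻¹' S) ((σ, γ)⁻¹ • m) else 0) -
        (if x ∈ σ ⁻¹' S then Val.gauge r D (σ ⁻¹' S) x ((σ, γ)⁻¹ • m) else 0) +
        (if σ x ∈ S then Val.gauge r E S (σ x) m else 0) := by
      intro x
      rw [e, Equiv.symm_apply_apply]
      by_cases hx : σ x ∈ S <;> simp [hx]
    refine (Finset.sum_congr rfl fun x _ => e2 x).trans ?_
    rw [Finset.sum_add_distrib, Finset.sum_sub_distrib, hgauge,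
      Equiv.sum_comp σ (fun x => if x ∈ S then Val.gauge r E S x m else 0)]
    simp
  φ_apply D E f γ s hs hP x := by
    have hx : ∀ (D : Set A) (x : A), x ∈ D →
        Val.translate (X := X) (Val.gauge (fun S m => AgreeOn S (str m) M) D) (x, 0) =
        (x, fun S m => Val.base (fun S m => AgreeOn S (str m) M) S x m) := by
      intro D x hx
      refine Prod.ext rfl ?_
      funext S m
      simp [Val.translate, Val.gauge, hx]
    rw [← hx D x x.2, ← hx E (f x) (f x).2]
    simp only [Perm.mul_apply]
    rw [← extendPerm_apply, Perm.inv_def, Equiv.symm_apply_apply]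
    rfl
  preserves := by
    rintro ⟨h, γ⟩ ⟨σ, hσ, hs⟩ D f hf
    have hfσ : ∀ x ∈ D, σ x = f x := fun x hx => by
      have := hf x hx
      rw [← hσ (x, _)]
      exact congrArg Prod.fst this
    refine preservesOn_congr hfσ ?_
    -- The sum over the empty set carries no information; this case uses that there are no symbols
    -- of arity zero.
    rcases D.eq_empty_or_nonempty with rfl | hne
    · refine ⟨fun n R x hx => ?_, fun n F x hx y hy => hy.elim, fun n F x hx => ?_⟩
      · rcases n with _ | n
        · exact hR.elim R
        · exact (hx 0).elim
      · rcases n with _ | n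
        · exact hF.elim F
        · exact (hx 0).elim
    have hD : σ ⁻¹' (σ.symm ⁻¹' D) = D := by rw [← Set.preimage_comp]; simp
    rw [← hD]
    refine (preservesOn_iff_agreeOn (S := σ.symm ⁻¹' D) (σ, γ)).2 ?_
    -- The test is made on the image of `D` at the index of `(σ, γ) • M`. The right side is 1, as
    -- `M` agrees with itself on `D`; the left side is 1 only if `(σ, γ) • M` agrees with `M` on
    -- that image.
    have key := hs (fun x => (x, fun S m => Val.base (fun S m => AgreeOn S (str m) M) S x m))
      (fun x => rfl) (σ.symm ⁻¹' D) ((σ, γ) • m₀)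
    rw [inv_smul_smul, hD] at key
    unfold Val.sectionSum at key
    have h1 : ∀ x : A, (if x ∈ σ.symm ⁻¹' D then (h (σ.symm x, fun S m =>
        Val.base (fun S m => AgreeOn S (str m) M) S (σ.symm x) m)).2 (σ.symm ⁻¹' D)
          ((σ, γ) • m₀) else 0) =
        if x ∈ σ.symm ⁻¹' D then Val.base (fun S m => AgreeOn S (str m) M) (σ.symm ⁻¹' D) x
          ((σ, γ) • m₀) else 0 := by
      intro x
      by_cases hx : σ.symm x ∈ D
      · have h2 := hf _ hx
        rw [← hfσ _ hx, Equiv.apply_symm_apply] at h2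
        simp only at h2
        rw [h2]
      · simp [hx]
    have hne' : (σ.symm ⁻¹' D).Nonempty := by
      obtain ⟨x, hx⟩ := hne
      exact ⟨σ x, by simpa using hx⟩
    have h3 := (Finset.sum_congr rfl fun x _ => h1 x).symm.trans key
    rw [Val.sum_base _ hne', Val.sum_base _ hne, hm₀, if_pos (AgreeOn.refl D M), hstr, hm₀] at h3
    by_contra hcon
    rw [if_neg hcon] at h3
    exact absurd h3 (by decide)

/-- Amalgams exist for the structures in finite orbits. -/
theorem exists_amalgam [Finite A] (hR : IsEmpty (L.Relations 0))
    (hF : IsEmpty (L.Functions 0)) (Γ : Subgroup (LangPerm L)) (M : Str L A)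
    (hM : InFiniteOrbit Γ M) : ∃ (B : Type w) (_ : Finite B), Nonempty (Amalgam Γ M B) := by
  have := Fintype.ofFinite A
  have hfin : Finite (MulAction.orbit (Perm A × Γ) M) := finite_orbit_relabel hM
  -- The orbit lives in a universe that also involves the language; being finite, it is small.
  refine ⟨Val A (Shrink.{w} (MulAction.orbit (Perm A × Γ) M)), inferInstance,
    ⟨valuationAmalgam hR hF Γ M (Shrink.{w} (MulAction.orbit (Perm A × Γ) M))
      (fun m => ((equivShrink _).symm m).1) (fun g m => ?_)
      (equivShrink _ ⟨M, MulAction.mem_orbit_self M⟩) (by simp)⟩⟩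
  rw [equivShrink_symm_smul]
  rfl

/-! ### Conformal covers -/

namespace Amalgam

variable {Γ : Subgroup (LangPerm L)} {M : Str L A} (W : Amalgam Γ M B)

/-- `S` is contained in the image of `A` under an element of the group. -/
def InCopy (S : Set B) : Prop := ∃ h ∈ W.H, ∀ b ∈ S, ∃ a, h.1 (W.ψ a) = b

/-- Sets that are pairwise contained in copies of `A` are contained in copies of `A`. -/
def IsConformal : Prop :=
  ∀ C : Set B, (∀ b ∈ C, ∀ b' ∈ C, W.InCopy {b, b'}) → W.InCopy C

/-- An injective tuple of vertices which is contained in no copy of `A`. -/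
def IsBad {n : ℕ} (s : Fin n → B) : Prop :=
  Function.Injective s ∧ ¬ W.InCopy (Set.range s)

variable {W}

theorem InCopy.map {S : Set B} (hS : W.InCopy S) {h : Perm B × Γ} (hh : h ∈ W.H) :
    W.InCopy (h.1 '' S) := by
  obtain ⟨k, hk, hkS⟩ := hS
  refine ⟨h * k, W.H.mul_mem hh hk, ?_⟩
  rintro _ ⟨b, hb, rfl⟩
  obtain ⟨a, rfl⟩ := hkS b hb
  exact ⟨a, rfl⟩

theorem IsBad.map {n : ℕ} {s : Fin n → B} (hs : W.IsBad s) {h : Perm B × Γ} (hh : h ∈ W.H) :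
    W.IsBad (h.1 ∘ s) := by
  refine ⟨h.1.injective.comp hs.1, fun hc => hs.2 ?_⟩
  have := hc.map (W.H.inv_mem hh)
  rw [Set.range_comp, ← Set.image_comp] at this
  have e : (h⁻¹.1 ∘ h.1 : B → B) = id := by
    funext b
    exact h.1.symm_apply_apply b
  rwa [e, Set.image_id] at this

theorem isBad_comp_iff {n : ℕ} {s : Fin n → B} {h : Perm B × Γ} (hh : h ∈ W.H) :
    W.IsBad (h.1 ∘ s) ↔ W.IsBad s := by
  refine ⟨fun hs => ?_, fun hs => hs.map hh⟩
  have := hs.map (W.H.inv_mem hh)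
  have e : h⁻¹.1 ∘ h.1 ∘ s = s := by
    funext b
    exact h.1.symm_apply_apply _
  rwa [e] at this

theorem isBad_symm_comp_iff {n : ℕ} {s : Fin n → B} {h : Perm B × Γ} (hh : h ∈ W.H) :
    W.IsBad (h.1.symm ∘ s) ↔ W.IsBad s :=
  isBad_comp_iff (h := h⁻¹) (W.H.inv_mem hh)

/-- Dropping one index outside `J` leaves `k + 1` indices, one for each colour. -/
theorem exists_injOn_fin {k : ℕ} (J : Set (Fin (k + 2))) :
    ∃ c : Fin (k + 2) → Fin (k + 1), J ≠ Set.univ → Set.InjOn c J := by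
  by_cases hJ : J = Set.univ
  · exact ⟨fun _ => 0, fun h => (h hJ).elim⟩
  · obtain ⟨j, hj⟩ := (Set.ne_univ_iff_exists_notMem J).1 hJ
    refine ⟨fun i => if h : i ≠ j then (finSuccAboveEquiv j).symm ⟨i, h⟩ else 0, ?_⟩
    intro _ x hx y hy hxy
    have h1 : x ≠ j := fun h => hj (h ▸ hx)
    have h2 : y ≠ j := fun h => hj (h ▸ hy)
    simp only [ne_eq, h1, not_false_eq_true, dite_true, h2] at hxy
    simpa using (finSuccAboveEquiv j).symm.injective hxy

/-- A colouring of the indices, injective on `J` unless `J` is everything. -/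
noncomputable def indexColour {k : ℕ} (J : Set (Fin (k + 2))) : Fin (k + 2) → Fin (k + 1) :=
  (exists_injOn_fin J).choose

theorem indexColour_injOn {k : ℕ} {J : Set (Fin (k + 2))} (hJ : J ≠ Set.univ) :
    Set.InjOn (indexColour J) J := (exists_injOn_fin J).choose_spec hJ

variable (W)

/-- The indices of the entries of `s` that are in the image of `D`. -/
def indexSet (D : Set A) {n : ℕ} (s : Fin n → B) : Set (Fin n) := {i | ∃ a ∈ D, W.ψ a = s i}

theorem indexSet_mono {D E : Set A} (h : D ⊆ E) {n : ℕ} (s : Fin n → B) :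
    W.indexSet D s ⊆ W.indexSet E s := fun _ ⟨a, ha, e⟩ => ⟨a, h ha, e⟩

variable {W} in
theorem IsBad.indexSet_ne_univ {n : ℕ} {s : Fin n → B} (hs : W.IsBad s) (D : Set A) :
    W.indexSet D s ≠ Set.univ := by
  intro h
  refine hs.2 ⟨1, W.H.one_mem, ?_⟩
  rintro _ ⟨i, rfl⟩
  obtain ⟨a, -, ha⟩ := (h ▸ Set.mem_univ i : i ∈ W.indexSet D s)
  exact ⟨a, ha⟩

/-- Vertices of the conformal cover: a vertex of `B` with a colour for every tuple of `k + 2`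
vertices, out of `k + 1` colours. -/
abbrev Cover (B : Type w) : Type w :=
  B × (∀ k : Fin (Nat.card B), (Fin (k + 2) → B) → Fin (k + 1))

/-- The vertex above `ψ a`, coloured by the canonical colourings with respect to `D`. -/
noncomputable def coverEmb (D : Set A) (a : A) : Cover B :=
  (W.ψ a, fun _ s => if h : W.IsBad s ∧ ∃ i, s i = W.ψ a then
    indexColour (W.indexSet D s) h.2.choose else 0)

theorem coverEmb_of_isBad (D : Set A) (a : A) {k : Fin (Nat.card B)} {s : Fin (k + 2) → B}
    (hs : W.IsBad s) {i : Fin (k + 2)} (hi : s i = W.ψ a) :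
    (W.coverEmb D a).2 k s = indexColour (W.indexSet D s) i := by
  have h : W.IsBad s ∧ ∃ i, s i = W.ψ a := ⟨hs, i, hi⟩
  have e : h.2.choose = i := hs.1 (h.2.choose_spec.trans hi.symm)
  simp only [coverEmb]
  rw [dif_pos h, e]

theorem coverEmb_of_not (D : Set A) (a : A) {k : Fin (Nat.card B)} {s : Fin (k + 2) → B}
    (h : ¬ (W.IsBad s ∧ ∃ i, s i = W.ψ a)) : (W.coverEmb D a).2 k s = 0 := by
  simp only [coverEmb]
  rw [dif_neg h]

/-- The lift of a permutation of `B` to the cover. -/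
def coverLift (h : Perm B) : Perm (Cover B) where
  toFun b := (h b.1, fun k s => b.2 k (h.symm ∘ s))
  invFun b := (h.symm b.1, fun k s => b.2 k (h ∘ s))
  left_inv b := by
    refine Prod.ext (by simp) ?_
    funext k s
    simp [← Function.comp_assoc]
  right_inv b := by
    refine Prod.ext (by simp) ?_
    funext k s
    simp [← Function.comp_assoc]

/-- Permuting the colours in each fibre. -/
def recolour (τ : ∀ k : Fin (Nat.card B), (Fin (k + 2) → B) → B → Perm (Fin (k + 1))) :
    Perm (Cover B) where
  toFun b := (b.1, fun k s => τ k s b.1 (b.2 k s))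
  invFun b := (b.1, fun k s => (τ k s b.1).symm (b.2 k s))
  left_inv b := by simp
  right_inv b := by simp

/-- Both colourings are injective on the smaller index set, because a bad tuple never lies inside
the image of `A`. -/
theorem exists_gauge (D : Set A) {k : ℕ} (s : Fin (k + 2) → B) :
    ∃ τ : Perm (Fin (k + 1)), W.IsBad s → ∀ i ∈ W.indexSet D s,
      τ (indexColour (W.indexSet D s) i) = indexColour (W.indexSet Set.univ s) i := by
  by_cases hs : W.IsBad s
  · obtain ⟨τ, hτ⟩ := exists_perm_comp_eq
      (fun i : W.indexSet D s => indexColour (W.indexSet D s) i)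
      (fun i : W.indexSet D s => indexColour (W.indexSet Set.univ s) i)
      (Set.injOn_iff_injective.1 (indexColour_injOn (hs.indexSet_ne_univ D)))
      (Set.injOn_iff_injective.1 ((indexColour_injOn (hs.indexSet_ne_univ Set.univ)).mono
        (W.indexSet_mono (Set.subset_univ D) s)))
    exact ⟨τ, fun _ i hi => hτ ⟨i, hi⟩⟩
  · exact ⟨1, fun h => (hs h).elim⟩

/-- Permutations of the colours taking the canonical colouring with respect to `D` to the one with
respect to `A`. -/
noncomputable def colourGauge (D : Set A) (k : Fin (Nat.card B)) (s : Fin (k + 2) → B) (b : B) :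
    Perm (Fin (k + 1)) :=
  if W.IsBad s ∧ b ∈ Set.range s then (W.exists_gauge D s).choose else 1

theorem recolour_colourGauge (D : Set A) {a : A} (ha : a ∈ D) :
    recolour (W.colourGauge D) (W.coverEmb D a) = W.coverEmb Set.univ a := by
  refine Prod.ext rfl ?_
  funext k s
  change W.colourGauge D k s (W.ψ a) ((W.coverEmb D a).2 k s) = _
  by_cases h : W.IsBad s ∧ ∃ i, s i = W.ψ a
  · obtain ⟨hs, i, hi⟩ := h
    rw [W.coverEmb_of_isBad D a hs hi, W.coverEmb_of_isBad _ a hs hi, colourGauge,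
      if_pos ⟨hs, i, hi⟩]
    exact (W.exists_gauge D s).choose_spec hs i ⟨a, ha, hi.symm⟩
  · rw [W.coverEmb_of_not D a h, W.coverEmb_of_not _ a h, colourGauge,
      if_neg (show ¬ (W.IsBad s ∧ W.ψ a ∈ Set.range s) from h)]
    rfl

/-- The permutations of the cover that lift elements of the group and preserve equality of colours
at all bad tuples. -/
def coverGroup : Subgroup (Perm (Cover B) × Γ) where
  carrier := {h | ∃ h₀ : Perm B, (h₀, h.2) ∈ W.H ∧ (∀ b, (h.1 b).1 = h₀ b.1) ∧
    ∀ (k : Fin (Nat.card B)) (s : Fin (k + 2) → B), W.IsBad s → ∀ b b' : Cover B,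
      b.1 ∈ Set.range s → b'.1 ∈ Set.range s →
        (b.2 k s = b'.2 k s ↔ (h.1 b).2 k (h₀ ∘ s) = (h.1 b').2 k (h₀ ∘ s))}
  one_mem' := ⟨1, W.H.one_mem, fun _ => rfl, fun _ _ _ _ _ _ _ => Iff.rfl⟩
  mul_mem' := by
    rintro h g ⟨h₀, hh, h1, h2⟩ ⟨g₀, hg, g1, g2⟩
    refine ⟨h₀ * g₀, W.H.mul_mem hh hg, fun b => ?_, fun k s hs b b' hb hb' => ?_⟩
    · change (h.1 (g.1 b)).1 = _
      rw [h1, g1]; rfl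
    · have key : ∀ b : Cover B, b.1 ∈ Set.range s → (g.1 b).1 ∈ Set.range (g₀ ∘ s) := by
        rintro b ⟨i, hi⟩
        exact ⟨i, by rw [g1, ← hi]; rfl⟩
      exact (g2 k s hs b b' hb hb').trans
        (h2 k (g₀ ∘ s) (hs.map hg) _ _ (key b hb) (key b' hb'))
  inv_mem' := by
    rintro h ⟨h₀, hh, h1, h2⟩
    have hi : ∀ b, (h.1.symm b).1 = h₀.symm b.1 := fun b => by
      rw [Equiv.eq_symm_apply, ← h1, Equiv.apply_symm_apply]
    refine ⟨h₀⁻¹, W.H.inv_mem hh, hi, fun k s hs b b' hb hb' => ?_⟩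
    have key : ∀ b : Cover B, b.1 ∈ Set.range s → (h.1.symm b).1 ∈ Set.range (h₀.symm ∘ s) := by
      rintro b ⟨i, hi'⟩
      exact ⟨i, by rw [hi, ← hi']; rfl⟩
    have := h2 k (h₀.symm ∘ s) ((isBad_symm_comp_iff hh).2 hs) _ _ (key b hb) (key b' hb')
    rw [Equiv.apply_symm_apply, Equiv.apply_symm_apply, ← Function.comp_assoc,
      Equiv.self_comp_symm, Function.id_comp] at this
    exact this.symm

theorem coverLift_mem {h : Perm B × Γ} (hh : h ∈ W.H) :
    (coverLift h.1, h.2) ∈ W.coverGroup := by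
  refine ⟨h.1, hh, fun _ => rfl, fun k s hs b b' hb hb' => ?_⟩
  change _ ↔ b.2 k (h.1.symm ∘ h.1 ∘ s) = b'.2 k (h.1.symm ∘ h.1 ∘ s)
  rw [← Function.comp_assoc, Equiv.symm_comp_self, Function.id_comp]

theorem recolour_mem (τ : ∀ k : Fin (Nat.card B), (Fin (k + 2) → B) → B → Perm (Fin (k + 1)))
    (hτ : ∀ (k : Fin (Nat.card B)) (s : Fin (k + 2) → B), W.IsBad s → ∀ b b' : B,
      b ∈ Set.range s → b' ∈ Set.range s → τ k s b = τ k s b') :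
    (recolour τ, (1 : Γ)) ∈ W.coverGroup := by
  refine ⟨1, W.H.one_mem, fun _ => rfl, fun k s hs b b' hb hb' => ?_⟩
  change _ ↔ τ k s b.1 (b.2 k s) = τ k s b'.1 (b'.2 k s)
  rw [hτ k s hs _ _ hb hb', (τ k s b'.1).injective.eq_iff]

theorem colourGauge_mem (D : Set A) : (recolour (W.colourGauge D), (1 : Γ)) ∈ W.coverGroup :=
  W.recolour_mem _ fun k s hs b b' hb hb' => by
    rw [colourGauge, colourGauge, if_pos ⟨hs, hb⟩, if_pos ⟨hs, hb'⟩]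

/-- The canonical colour depends on the tuple only through badness and the index set, and `h`
respects both. This exact equivariance is the reason for having a separate colouring for each `D`.
-/
theorem coverLift_coverEmb {D E : Set A} {h : Perm B × Γ} (hh : h ∈ W.H) (f : D ≃ E)
    (hf : ∀ x : D, h.1 (W.ψ x) = W.ψ (f x)) (a : D) :
    coverLift h.1 (W.coverEmb D a) = W.coverEmb E (f a) := by
  refine Prod.ext (hf a) ?_
  funext k s
  change (W.coverEmb D a).2 k (h.1.symm ∘ s) = _
  have hJ : W.indexSet D (h.1.symm ∘ s) = W.indexSet E s := by
    ext i
    constructor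
    · rintro ⟨x, hx, e⟩
      refine ⟨f ⟨x, hx⟩, (f ⟨x, hx⟩).2, ?_⟩
      rw [← hf ⟨x, hx⟩]
      exact (Equiv.eq_symm_apply _).1 e
    · rintro ⟨y, hy, e⟩
      refine ⟨f.symm ⟨y, hy⟩, (f.symm ⟨y, hy⟩).2, (Equiv.eq_symm_apply _).2 ?_⟩
      rw [hf]
      simpa using e
  have hi : ∀ i, (h.1.symm ∘ s) i = W.ψ a ↔ s i = W.ψ (f a) := fun i => by
    rw [← hf a, Function.comp_apply, Equiv.symm_apply_eq]
  by_cases hs : W.IsBad s ∧ ∃ i, s i = W.ψ (f a)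
  · obtain ⟨hs, i, e⟩ := hs
    rw [W.coverEmb_of_isBad E _ hs e,
      W.coverEmb_of_isBad D a ((isBad_symm_comp_iff hh).2 hs) ((hi i).2 e), hJ]
  · rw [W.coverEmb_of_not E _ hs, W.coverEmb_of_not D a]
    rintro ⟨h1, i, h2⟩
    exact hs ⟨(isBad_symm_comp_iff hh).1 h1, i, (hi i).1 h2⟩

/-- The amalgam on the cover. -/
noncomputable def cover : Amalgam Γ M (Cover B) where
  H := W.coverGroup
  ψ := W.coverEmb Set.univ
  ψ_injective x y h := W.ψ_injective (congrArg Prod.fst h)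
  -- As with valuations, conjugating by gauges that depend only on the domain and the range
  -- preserves coherence.
  φ D E f γ := (recolour (W.colourGauge E), 1) * (coverLift (W.φ D E f γ).1, (W.φ D E f γ).2) *
    (recolour (W.colourGauge D), 1)⁻¹
  φ_snd D E f γ := by simp [W.φ_snd]
  φ_trans D E F f g γ δ := by
    have : (coverLift (W.φ D F (f.trans g) (δ * γ)).1, (W.φ D F (f.trans g) (δ * γ)).2) =
        (coverLift (W.φ E F g δ).1, (W.φ E F g δ).2) *
          (coverLift (W.φ D E f γ).1, (W.φ D E f γ).2) := by
      rw [W.φ_trans]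
      rfl
    rw [this]
    group
  φ_mem D E f γ s hs hP := W.coverGroup.mul_mem
    (W.coverGroup.mul_mem (W.colourGauge_mem E) (W.coverLift_mem (W.φ_mem D E f γ s hs hP)))
    (W.coverGroup.inv_mem (W.colourGauge_mem D))
  φ_apply D E f γ s hs hP x := by
    rw [← W.recolour_colourGauge D x.2, ← W.recolour_colourGauge E (f x).2,
      ← W.coverLift_coverEmb (W.φ_mem D E f γ s hs hP) f (W.φ_apply D E f γ s hs hP)]
    change recolour (W.colourGauge E) (coverLift (W.φ D E f γ).1
      ((recolour (W.colourGauge D)).symm _)) = _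
    rw [Equiv.symm_apply_apply]
  preserves := by
    rintro h ⟨h₀, hh, h1, -⟩ D f hf
    refine W.preserves (h₀, h.2) hh D f fun x hx => ?_
    have := congrArg Prod.fst (hf x hx)
    rw [h1] at this
    exact this

/-- Pulled back along `h₀`, the two colours are canonical colours at distinct entries of a bad
tuple, and these differ. -/
theorem cover_colour_ne {h : Perm (Cover B) × Γ} (hh : h ∈ W.coverGroup) {a a' : A} (ha : a ≠ a')
    {k : Fin (Nat.card B)} {s : Fin (k + 2) → B} (hs : W.IsBad s)
    (h1 : (h.1 (W.coverEmb Set.univ a)).1 ∈ Set.range s)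
    (h2 : (h.1 (W.coverEmb Set.univ a')).1 ∈ Set.range s) :
    (h.1 (W.coverEmb Set.univ a)).2 k s ≠ (h.1 (W.coverEmb Set.univ a')).2 k s := by
  obtain ⟨h₀, hh, hb, hc⟩ := hh
  rw [hb] at h1 h2
  obtain ⟨i, hi⟩ := h1
  obtain ⟨j, hj⟩ := h2
  have hi' : (h₀.symm ∘ s) i = W.ψ a := (Equiv.symm_apply_eq _).2 hi
  have hj' : (h₀.symm ∘ s) j = W.ψ a' := (Equiv.symm_apply_eq _).2 hj
  have hs' := (isBad_symm_comp_iff hh).2 hs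
  have key := hc k _ hs' (W.coverEmb Set.univ a) (W.coverEmb Set.univ a') ⟨i, hi'⟩ ⟨j, hj'⟩
  rw [← Function.comp_assoc, Equiv.self_comp_symm, Function.id_comp] at key
  rw [Ne, ← key, W.coverEmb_of_isBad _ _ hs' hi', W.coverEmb_of_isBad _ _ hs' hj']
  intro e
  have := indexColour_injOn (hs'.indexSet_ne_univ Set.univ) ⟨a, trivial, hi'.symm⟩
    ⟨a', trivial, hj'.symm⟩ e
  subst this
  exact ha (W.ψ_injective (hi'.symm.trans hj'))

theorem cover_isConformal [Finite B] : W.cover.IsConformal := by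
  intro C hC
  have hinj : ∀ b ∈ C, ∀ b' ∈ C, b.1 = b'.1 → b = b' := by
    intro b hb b' hb' e
    obtain ⟨h, ⟨h₀, -, h1, -⟩, hh⟩ := hC b hb b' hb'
    obtain ⟨a, rfl⟩ := hh b (by simp)
    obtain ⟨a', rfl⟩ := hh b' (by simp)
    rw [h1, h1] at e
    rw [W.ψ_injective (h₀.injective e)]
  have hcol : ∀ b ∈ C, ∀ b' ∈ C, b.1 ≠ b'.1 → ∀ (k : Fin (Nat.card B)) (s : Fin (k + 2) → B),
      W.IsBad s → b.1 ∈ Set.range s → b'.1 ∈ Set.range s → b.2 k s ≠ b'.2 k s := by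
    intro b hb b' hb' e k s hs h1 h2
    obtain ⟨h, hH, hh⟩ := hC b hb b' hb'
    obtain ⟨a, rfl⟩ := hh b (by simp)
    obtain ⟨a', rfl⟩ := hh b' (by simp)
    exact W.cover_colour_ne hH (fun h => e (by rw [h])) hs h1 h2
  -- If the projection of `C` lay in no copy, an enumeration of it would be a bad tuple whose `k +
  -- 2` entries get distinct colours out of `k + 1`. Lengths 0 and 1 carry no colours and are
  -- treated directly.
  have hproj : W.InCopy (Prod.fst '' C) := by
    by_contra hbad
    have hfin : (Prod.fst '' C).Finite := Set.toFinite _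
    obtain ⟨n, s, hs, hrange⟩ : ∃ (n : ℕ) (s : Fin n → B), Function.Injective s ∧
        Set.range s = Prod.fst '' C := by
      refine ⟨_, fun i => ((Finite.equivFin ↥(Prod.fst '' C)).symm i : B),
        Subtype.val_injective.comp (Equiv.injective _), ?_⟩
      rw [show (fun i => ((Finite.equivFin ↥(Prod.fst '' C)).symm i : B)) =
        Subtype.val ∘ (Finite.equivFin ↥(Prod.fst '' C)).symm from rfl,
        EquivLike.range_comp, Subtype.range_coe]
    have hc : ∀ i, ∃ b ∈ C, b.1 = s i := fun i => by
      have : s i ∈ Prod.fst '' C := hrange ▸ ⟨i, rfl⟩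
      exact this
    choose c hcC hcs using hc
    match n, s, hs, hrange, c, hcC, hcs with
    | 0, s, hs, hrange, c, hcC, hcs =>
      exact hbad ⟨1, W.H.one_mem, fun b hb => by
        rw [← hrange] at hb
        obtain ⟨i, -⟩ := hb
        exact i.elim0⟩
    | 1, s, hs, hrange, c, hcC, hcs =>
      obtain ⟨h, ⟨h₀, hH, h1, -⟩, hh⟩ := hC (c 0) (hcC 0) (c 0) (hcC 0)
      refine hbad ⟨_, hH, fun b hb => ?_⟩
      rw [← hrange] at hb
      obtain ⟨i, rfl⟩ := hb
      obtain ⟨a, ha⟩ := hh (c 0) (by simp)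
      refine ⟨a, ?_⟩
      rw [Subsingleton.elim i 0, ← hcs 0, ← ha, h1]
      rfl
    | k + 2, s, hs, hrange, c, hcC, hcs =>
      have hk : k < Nat.card B := by
        have := Nat.card_le_card_of_injective s hs
        rw [Nat.card_fin] at this
        omega
      have hsbad : W.IsBad s := ⟨hs, hrange ▸ hbad⟩
      have hinj' : Function.Injective fun i => (c i).2 ⟨k, hk⟩ s := by
        intro i j hij
        by_contra hne
        refine hcol (c i) (hcC i) (c j) (hcC j) ?_ ⟨k, hk⟩ s hsbad ⟨i, (hcs i).symm⟩
          ⟨j, (hcs j).symm⟩ hij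
        rw [hcs, hcs]
        exact fun h => hne (hs h)
      have := Fintype.card_le_of_injective _ hinj'
      simp at this
  obtain ⟨h, hH, hh⟩ := hproj
  have hlift := W.coverLift_mem hH
  rcases isEmpty_or_nonempty A with hA | hA
  · exact ⟨1, W.coverGroup.one_mem, fun b hb => hA.elim (hh b.1 ⟨b, hb, rfl⟩).choose⟩
  choose! a ha using fun b (hb : b ∈ C) => hh b.1 ⟨b, hb, rfl⟩
  set c : Cover B → Cover B := fun b => coverLift h.1 (W.coverEmb Set.univ (a b)) with hcdef
  have hc1 : ∀ b ∈ C, (c b).1 = b.1 := ha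
  -- The lifted copy and `C` project to the same vertices, so only colours need correcting. At a bad
  -- tuple, one permutation must serve all its entries; it exists because both colourings are
  -- injective there.
  have hτ : ∀ (k : Fin (Nat.card B)) (s : Fin (k + 2) → B),
      ∃ τ : B → Perm (Fin (k + 1)), (∀ b ∈ C, τ b.1 ((c b).2 k s) = b.2 k s) ∧
        (W.IsBad s → ∀ b b' : B, b ∈ Set.range s → b' ∈ Set.range s → τ b = τ b') := by
    intro k s
    -- Off the tuple, fibres are recoloured independently; each contains at most one vertex of `C`,
    -- so a transposition suffices.
    have hsingle : ∀ b₀ : B, ∃ τ : Perm (Fin (k + 1)), ∀ b ∈ C, b.1 = b₀ →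
        τ ((c b).2 k s) = b.2 k s := by
      intro b₀
      by_cases hb₀ : ∃ b ∈ C, b.1 = b₀
      · obtain ⟨b, hb, rfl⟩ := hb₀
        refine ⟨Equiv.swap ((c b).2 k s) (b.2 k s), fun b' hb' e => ?_⟩
        rw [hinj b' hb' b hb e, Equiv.swap_apply_left]
      · exact ⟨1, fun b hb e => (hb₀ ⟨b, hb, e⟩).elim⟩
    choose τ₀ hτ₀ using hsingle
    by_cases hs : W.IsBad s
    · obtain ⟨τ, hτ⟩ := exists_perm_comp_eq
        (fun b : {b : Cover B // b ∈ C ∧ b.1 ∈ Set.range s} => (c b).2 k s)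
        (fun b => b.1.2 k s)
        (by
          rintro ⟨b, hb, hbs⟩ ⟨b', hb', hbs'⟩ e
          by_contra hne
          refine W.cover_colour_ne hlift (a := a b) (a' := a b') ?_ hs ?_ ?_ e
          · intro e'
            refine hne (Subtype.ext (hinj b hb b' hb' ?_))
            rw [← ha b hb, ← ha b' hb', e']
          · exact (hc1 b hb).symm ▸ hbs
          · exact (hc1 b' hb').symm ▸ hbs')
        (by
          rintro ⟨b, hb, hbs⟩ ⟨b', hb', hbs'⟩ e
          by_contra hne
          refine hcol b hb b' hb' ?_ k s hs hbs hbs' e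
          exact fun e' => hne (Subtype.ext (hinj b hb b' hb' e')))
      refine ⟨fun b₀ => if b₀ ∈ Set.range s then τ else τ₀ b₀, fun b hb => ?_,
        fun _ b b' hb hb' => ?_⟩
      · by_cases hbs : b.1 ∈ Set.range s
        · simp only [if_pos hbs]
          exact hτ ⟨b, hb, hbs⟩
        · simp only [if_neg hbs]
          exact hτ₀ _ b hb rfl
      · simp only [if_pos hb, if_pos hb']
    · exact ⟨τ₀, fun b hb => hτ₀ _ b hb rfl, fun h => (hs h).elim⟩
  choose τ hτ1 hτ2 using hτ
  refine ⟨(recolour τ, 1) * (coverLift h.1, h.2),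
    W.coverGroup.mul_mem (W.recolour_mem τ hτ2) hlift, fun b hb => ⟨a b, ?_⟩⟩
  refine Prod.ext (hc1 b hb) ?_
  funext k s
  rw [← hτ1 k s b hb, ← hc1 b hb]
  rfl

end Amalgam

/-! ### Closures -/

/-- The smallest substructure containing a vertex. -/
def vertexClosure (M : Str L A) (a : A) : Set A :=
  {y | ∀ S, IsSubstructure M S → a ∈ S → y ∈ S}

theorem mem_vertexClosure_self (M : Str L A) (a : A) : a ∈ vertexClosure M a := fun _ _ h => h

theorem vertexClosure_subset {M : Str L A} {S : Set A} (hS : IsSubstructure M S) {a : A}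
    (ha : a ∈ S) : vertexClosure M a ⊆ S := fun _ hy => hy S hS ha

theorem isSubstructure_vertexClosure (M : Str L A) (a : A) :
    IsSubstructure M (vertexClosure M a) :=
  fun n F x hx _ hy S hS ha => hS n F x (fun i => hx i S hS ha) hy

theorem LangPerm.func_apply_inv (g : LangPerm L) (n : ℕ) (F : L.Functions n) :
    g.1 n (g⁻¹.1 n F) = F := (g.1 n).apply_symm_apply F

theorem LangPerm.rel_apply_inv (g : LangPerm L) (n : ℕ) (R : L.Relations n) :
    g.2 n (g⁻¹.2 n R) = R := (g.2 n).apply_symm_apply R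

theorem LangPerm.func_inv_apply (g : LangPerm L) (n : ℕ) (F : L.Functions n) :
    g⁻¹.1 n (g.1 n F) = F := (g.1 n).symm_apply_apply F

theorem LangPerm.rel_inv_apply (g : LangPerm L) (n : ℕ) (R : L.Relations n) :
    g⁻¹.2 n (g.2 n R) = R := (g.2 n).symm_apply_apply R

theorem exists_eq_comp_of_mem_image {n : ℕ} {T : Set A} {f : A → B} {x : Fin n → B}
    (hx : ∀ i, x i ∈ f '' T) : ∃ y : Fin n → A, (∀ i, y i ∈ T) ∧ x = f ∘ y := by
  choose y hy e using hx
  exact ⟨y, hy, funext fun i => (e i).symm⟩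

/-- Preserving graphs only gives the inclusion of `f '' F x` in the new value; equality of sizes
rules out values escaping the image. -/
theorem PreservesOn.isSubstructure_image [Finite A] {M : Str L A} {T : Set A} {f : A → A}
    {g : LangPerm L} (h : PreservesOn M T f g) (hf : Set.InjOn f T) (hT : IsSubstructure M T) :
    IsSubstructure M (f '' T) := by
  intro n F x hx
  obtain ⟨y, hy, rfl⟩ := exists_eq_comp_of_mem_image hx
  have hsub := hT n (g⁻¹.1 n F) y hy
  have h1 : f '' M.func n (g⁻¹.1 n F) y ⊆ M.func n F (f ∘ y) := by
    rintro _ ⟨c, hc, rfl⟩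
    have := (h.func n (g⁻¹.1 n F) y hy c (hsub hc)).1 hc
    rwa [LangPerm.func_apply_inv] at this
  have h2 : f '' M.func n (g⁻¹.1 n F) y = M.func n F (f ∘ y) := by
    refine Set.eq_of_subset_of_ncard_le h1 ?_ (Set.toFinite _)
    rw [(hf.mono hsub).ncard_image, h.card n _ y hy, LangPerm.func_apply_inv]
  rw [← h2]
  exact Set.image_mono hsub

theorem PreservesOn.image_vertexClosure [Finite A] {M : Str L A} {T : Set A} {f : A → A}
    {g : LangPerm L} (h : PreservesOn M T f g) (hf : Set.InjOn f T) (hT : IsSubstructure M T)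
    {a : A} (ha : a ∈ T) : f '' vertexClosure M a = vertexClosure M (f a) := by
  have hcl := vertexClosure_subset hT ha
  apply Set.Subset.antisymm
  · rw [Set.image_subset_iff]
    have : IsSubstructure M (T ∩ f ⁻¹' vertexClosure M (f a)) := by
      intro n F y hy t ht
      have htT := hT n F y (fun i => (hy i).1) ht
      refine ⟨htT, ?_⟩
      have := (h.func n F y (fun i => (hy i).1) t htT).1 ht
      exact isSubstructure_vertexClosure M (f a) n _ _ (fun i => (hy i).2) this
    exact fun y hy => (vertexClosure_subset this ⟨ha, mem_vertexClosure_self M _⟩ hy).2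
  · refine vertexClosure_subset ?_ ⟨a, mem_vertexClosure_self M a, rfl⟩
    intro n F x hx z hz
    have hxT : ∀ i, x i ∈ f '' T := fun i => Set.image_mono hcl (hx i)
    obtain ⟨y, hy, rfl⟩ := exists_eq_comp_of_mem_image hx
    obtain ⟨t, ht, rfl⟩ := h.isSubstructure_image hf hT n F _ hxT hz
    have hyT : ∀ i, y i ∈ T := fun i => hcl (hy i)
    have := (h.func n (g⁻¹.1 n F) y hyT t ht).2 (by rwa [LangPerm.func_apply_inv])
    exact ⟨t, isSubstructure_vertexClosure M a n _ y hy this, rfl⟩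

/-! ### The witness -/

namespace Amalgam

variable {Γ : Subgroup (LangPerm L)} {M : Str L A} (W : Amalgam Γ M B)

/-- Vertices of the witness: the images of vertices of `A`, together with the images of their
closures. -/
def Point : Type w :=
  {p : B × Set B // ∃ h ∈ W.H, ∃ a, p = (h.1 (W.ψ a), h.1 '' (W.ψ '' vertexClosure M a))}

instance [Finite B] : Finite W.Point := Subtype.finite

instance : MulAction W.H W.Point where
  smul h p := ⟨(h.1.1 p.1.1, h.1.1 '' p.1.2), by
    obtain ⟨k, hk, a, e⟩ := p.2
    refine ⟨h.1 * k, W.H.mul_mem h.2 hk, a, ?_⟩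
    rw [e]
    exact Prod.ext rfl (Set.image_comp h.1.1 k.1 _).symm⟩
  one_smul p := Subtype.ext (Prod.ext rfl (Set.image_id _))
  mul_smul h k p := Subtype.ext (Prod.ext rfl (Set.image_comp h.1.1 k.1.1 _))

/-- The vertex of the witness that corresponds to a vertex of `A`. -/
def point (a : A) : W.Point :=
  ⟨(W.ψ a, W.ψ '' vertexClosure M a), 1, W.H.one_mem, a, Prod.ext rfl (Set.image_id _).symm⟩

theorem point_injective : Function.Injective W.point := fun _ _ h =>
  W.ψ_injective (congrArg (fun p => p.1.1) h)

theorem exists_smul_point (p : W.Point) : ∃ (h : W.H) (a : A), h • W.point a = p := by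
  obtain ⟨p, h, hh, a, rfl⟩ := p
  exact ⟨⟨h, hh⟩, a, rfl⟩

theorem smul_point_of_isSubstructure [Finite A] (h : W.H) {T : Set A} (hT : IsSubstructure M T)
    (f : A → A) (hf : ∀ x ∈ T, h.1.1 (W.ψ x) = W.ψ (f x)) {x : A} (hx : x ∈ T) :
    h • W.point x = W.point (f x) := by
  have hP := W.preserves h.1 h.2 T f hf
  have hinj : Set.InjOn f T := fun y hy z hz e => by
    have : h.1.1 (W.ψ y) = h.1.1 (W.ψ z) := by rw [hf y hy, hf z hz, e]
    exact W.ψ_injective (h.1.1.injective this)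
  refine Subtype.ext (Prod.ext (hf x hx) ?_)
  change h.1.1 '' (W.ψ '' vertexClosure M x) = W.ψ '' vertexClosure M (f x)
  rw [← hP.image_vertexClosure hinj hT hx, Set.image_image, Set.image_image]
  exact Set.image_congr fun y hy => hf y (vertexClosure_subset hT hx hy)

/-- A total function stands in for the partial map that `h` induces on `A`; its values elsewhere are
irrelevant. -/
theorem exists_partialMap (h : W.H) : ∃ f : A → A, ∀ a a', h.1.1 (W.ψ a) = W.ψ a' → f a = a' := by
  refine ⟨fun a => if e : ∃ a', h.1.1 (W.ψ a) = W.ψ a' then e.choose else a, fun a a' e => ?_⟩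
  have e' : ∃ a', h.1.1 (W.ψ a) = W.ψ a' := ⟨a', e⟩
  simp only [dif_pos e']
  exact W.ψ_injective (e'.choose_spec.symm.trans e)

/-- Equality of the second coordinates forces `h` to carry the whole closure of `a` into `A`. -/
theorem smul_point_of_eq [Finite A] (h : W.H) {a a' : A} (e : h • W.point a = W.point a') :
    ∃ f : A → A, f a = a' ∧ (∀ x ∈ vertexClosure M a, h • W.point x = W.point (f x)) ∧
      PreservesOn M (vertexClosure M a) f h.1.2 := by
  obtain ⟨f, hf⟩ := W.exists_partialMap h
  have h1 : h.1.1 (W.ψ a) = W.ψ a' := congrArg (fun p => p.1.1) e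
  have h2 : h.1.1 '' (W.ψ '' vertexClosure M a) = W.ψ '' vertexClosure M a' :=
    congrArg (fun p => p.1.2) e
  have key : ∀ x ∈ vertexClosure M a, h.1.1 (W.ψ x) = W.ψ (f x) := by
    intro x hx
    have : h.1.1 (W.ψ x) ∈ W.ψ '' vertexClosure M a' := h2 ▸ ⟨_, ⟨x, hx, rfl⟩, rfl⟩
    obtain ⟨y, -, hy⟩ := this
    rw [hf x y hy.symm, hy]
  exact ⟨f, hf a a' h1, fun x hx => W.smul_point_of_isSubstructure h
    (isSubstructure_vertexClosure M a) f key hx, W.preserves h.1 h.2 _ f key⟩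

/-- The structure on the witness: the union of the images of `M`. -/
def witness : Str L W.Point where
  func n F x := {b | ∃ (h : W.H) (y : Fin n → A), (x = fun i => h • W.point (y i)) ∧
    ∃ c ∈ M.func n ((h.1.2 : LangPerm L)⁻¹.1 n F) y, b = h • W.point c}
  rel n R := {x | ∃ (h : W.H) (y : Fin n → A), (x = fun i => h • W.point (y i)) ∧
    y ∈ M.rel n ((h.1.2 : LangPerm L)⁻¹.2 n R)}

/-- The range of `y` need not be a substructure, which is why `preserves` is required for arbitrary
sets `D`. -/
theorem point_mem_rel_iff (n : ℕ) (R : L.Relations n) (x : Fin n → A) :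
    x ∈ M.rel n R ↔ W.point ∘ x ∈ W.witness.rel n R := by
  constructor
  · intro hx
    exact ⟨1, x, funext fun i => (one_smul _ _).symm, hx⟩
  · rintro ⟨h, y, e, hy⟩
    obtain ⟨f, hf⟩ := W.exists_partialMap h
    have e1 : ∀ i, h.1.1 (W.ψ (y i)) = W.ψ (x i) := fun i =>
      (congrArg (fun p => p.1.1) (congrFun e i)).symm
    have e2 : ∀ i, f (y i) = x i := fun i => hf _ _ (e1 i)
    have hP := W.preserves h.1 h.2 (Set.range y) f (by
      rintro _ ⟨i, rfl⟩
      rw [e1, e2])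
    have := (hP.rel n _ y fun i => ⟨i, rfl⟩).1 hy
    rw [LangPerm.rel_apply_inv] at this
    rwa [show x = f ∘ y from funext fun i => (e2 i).symm]

/-- As functions are unary, a value lies in the closure of its single argument, where `h` acts as a
map preserving `M`. -/
theorem image_point_func [Finite A] (hF : ∀ n : ℕ, n ≠ 1 → IsEmpty (L.Functions n)) (n : ℕ)
    (F : L.Functions n) (x : Fin n → A) :
    W.point '' M.func n F x = W.witness.func n F (W.point ∘ x) := by
  apply Set.Subset.antisymm
  · rintro _ ⟨c, hc, rfl⟩
    exact ⟨1, x, funext fun i => (one_smul _ _).symm, c, hc, (one_smul _ _).symm⟩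
  · rintro b ⟨h, y, e, c, hc, rfl⟩
    by_cases hn : n = 1
    · subst hn
      obtain ⟨f, hf, hf', hP⟩ := W.smul_point_of_eq h (congrFun e 0).symm
      have hy : ∀ i, y i ∈ vertexClosure M (y 0) := fun i => by
        rw [Subsingleton.elim i 0]
        exact mem_vertexClosure_self M _
      have hcy := isSubstructure_vertexClosure M (y 0) 1 _ y hy hc
      have := (hP.func 1 _ y hy c hcy).1 hc
      rw [LangPerm.func_apply_inv] at this
      refine ⟨f c, ?_, (hf' c hcy).symm⟩
      rwa [show x = f ∘ y from funext fun i => by rw [Subsingleton.elim i 0]; exact hf.symm]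
    · exact (hF n hn).elim F

/-- The embedding of `M` into the witness. -/
def emb [Finite A] (hF : ∀ n : ℕ, n ≠ 1 → IsEmpty (L.Functions n)) : Emb Γ M W.witness where
  lang := 1
  toFun := W.point
  isEmbedding := ⟨W.point_injective, W.point_mem_rel_iff, W.image_point_func hF⟩

theorem smul_mem_rel (h : W.H) (n : ℕ) (R : L.Relations n) (x : Fin n → W.Point)
    (hx : x ∈ W.witness.rel n R) :
    (fun i => h • x i) ∈ W.witness.rel n ((h.1.2 : LangPerm L).2 n R) := by
  obtain ⟨k, y, rfl, hy⟩ := hx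
  refine ⟨h * k, y, funext fun i => (mul_smul _ _ _).symm, ?_⟩
  have : ((h * k).1.2 : LangPerm L)⁻¹.2 n ((h.1.2 : LangPerm L).2 n R) =
      (k.1.2 : LangPerm L)⁻¹.2 n R :=
    congrArg ((k.1.2 : LangPerm L)⁻¹.2 n) (LangPerm.rel_inv_apply _ n R)
  rwa [this]

theorem smul_mem_func (h : W.H) (n : ℕ) (F : L.Functions n) (x : Fin n → W.Point)
    (b : W.Point) (hb : b ∈ W.witness.func n F x) :
    h • b ∈ W.witness.func n ((h.1.2 : LangPerm L).1 n F) fun i => h • x i := by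
  obtain ⟨k, y, rfl, c, hc, rfl⟩ := hb
  refine ⟨h * k, y, funext fun i => (mul_smul _ _ _).symm, c, ?_, (mul_smul _ _ _).symm⟩
  have : ((h * k).1.2 : LangPerm L)⁻¹.1 n ((h.1.2 : LangPerm L).1 n F) =
      (k.1.2 : LangPerm L)⁻¹.1 n F :=
    congrArg ((k.1.2 : LangPerm L)⁻¹.1 n) (LangPerm.func_inv_apply _ n F)
  rwa [this]

theorem inv_smul_mem_rel (h : W.H) (n : ℕ) (R : L.Relations n) (x : Fin n → W.Point)
    (hx : (fun i => h • x i) ∈ W.witness.rel n ((h.1.2 : LangPerm L).2 n R)) :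
    x ∈ W.witness.rel n R := by
  have h1 := W.smul_mem_rel h⁻¹ n _ _ hx
  simp only [inv_smul_smul] at h1
  exact (LangPerm.rel_inv_apply (h.1.2 : LangPerm L) n R) ▸ h1

theorem inv_smul_mem_func (h : W.H) (n : ℕ) (F : L.Functions n) (x : Fin n → W.Point)
    (b : W.Point) (hb : b ∈ W.witness.func n ((h.1.2 : LangPerm L).1 n F) fun i => h • x i) :
    h⁻¹ • b ∈ W.witness.func n F x := by
  have h1 := W.smul_mem_func h⁻¹ n _ _ _ hb
  simp only [inv_smul_smul] at h1
  exact (LangPerm.func_inv_apply (h.1.2 : LangPerm L) n F) ▸ h1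

/-- The automorphism of the witness given by an element of the group. -/
def aut (h : W.H) : Aut Γ W.witness where
  lang := h.1.2
  toEquiv := MulAction.toPerm h
  isEmbedding := by
    refine ⟨MulAction.injective h, fun n R x => ⟨W.smul_mem_rel h n R x,
      W.inv_smul_mem_rel h n R x⟩, fun n F x => ?_⟩
    apply Set.Subset.antisymm
    · rintro _ ⟨b, hb, rfl⟩
      exact W.smul_mem_func h n F x b hb
    · intro b hb
      exact ⟨h⁻¹ • b, W.inv_smul_mem_func h n F x b hb, smul_inv_smul h b⟩

theorem isSubstructure_copy [Finite A] (hF : ∀ n : ℕ, n ≠ 1 → IsEmpty (L.Functions n)) (h : W.H) :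
    IsSubstructure W.witness {p | ∃ a, h • W.point a = p} := by
  intro n F x hx b hb
  choose y hy using hx
  have e : x = fun i => h • (W.point ∘ y) i := funext fun i => (hy i).symm
  rw [e, ← LangPerm.func_apply_inv (h.1.2 : LangPerm L) n F] at hb
  have := W.inv_smul_mem_func h n _ _ b hb
  rw [← W.image_point_func hF] at this
  obtain ⟨c, -, hc⟩ := this
  exact ⟨c, by rw [hc, smul_inv_smul]⟩

/-! ### Faithfulness -/

/-- If `p` and `q` share no copy, `C` is the free amalgamation of the vertices whose closure misses
`p` and those whose closure misses `q`. Copies are closed, so a vertex in neither part, or a related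
tuple crossing between the parts, would put `p` and `q` in one copy. -/
theorem exists_common_copy [Finite A] (hF : ∀ n : ℕ, n ≠ 1 → IsEmpty (L.Functions n))
    {C : Set W.Point} (hirr : IsIrreducible (W.witness.induce C)) {p q : W.Point} (hp : p ∈ C) (hq : q ∈ C) :
    ∃ (h : W.H) (a a' : A), h • W.point a = p ∧ h • W.point a' = q := by
  by_contra hcon
  have hclosed : ∀ r : W.Point, IsSubstructure (W.witness.induce C)
      {z : C | r ∉ vertexClosure W.witness z} := by
    intro r n F x hx y hy hr
    by_cases hn : n = 1
    · subst hn
      refine hx 0 (vertexClosure_subset (isSubstructure_vertexClosure W.witness (x 0)) ?_ hr)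
      refine isSubstructure_vertexClosure W.witness (x 0) 1 F (fun i => (x i : W.Point)) ?_ hy
      intro i
      rw [Subsingleton.elim i 0]
      exact mem_vertexClosure_self _ _
    · exact (hF n hn).elim F
  refine hirr ⟨{z : C | p ∉ vertexClosure W.witness z}, {z : C | q ∉ vertexClosure W.witness z},
    fun h => ?_, fun h => ?_, hclosed p, hclosed q, ?_, ?_, ?_⟩
  · exact (h ▸ Set.mem_univ (⟨p, hp⟩ : C) : (⟨p, hp⟩ : C) ∈
      {z : C | p ∉ vertexClosure W.witness z}) (mem_vertexClosure_self _ _)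
  · exact (h ▸ Set.mem_univ (⟨q, hq⟩ : C) : (⟨q, hq⟩ : C) ∈
      {z : C | q ∉ vertexClosure W.witness z}) (mem_vertexClosure_self _ _)
  · refine Set.eq_univ_of_forall fun z => ?_
    by_contra hz
    simp only [Set.mem_union, Set.mem_ofPred_eq, not_or, not_not] at hz
    obtain ⟨h, a, ha⟩ := W.exists_smul_point z
    have hsub := vertexClosure_subset (W.isSubstructure_copy hF h) (a := (z : W.Point)) ⟨a, ha⟩
    obtain ⟨a, ha⟩ := hsub hz.1
    obtain ⟨a', ha'⟩ := hsub hz.2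
    exact hcon ⟨h, a, a', ha, ha'⟩
  · rintro n R x ⟨i, hi⟩ ⟨j, hj⟩ hx
    obtain ⟨h, y, e, -⟩ := hx
    have hmem : ∀ i, ∃ a, h • W.point a = (x i : W.Point) := fun i => ⟨y i, (congrFun e i).symm⟩
    have hsub := fun i => vertexClosure_subset (W.isSubstructure_copy hF h) (hmem i)
    have hq' : q ∈ vertexClosure W.witness (x i) := not_not.1 hi.2
    have hp' : p ∈ vertexClosure W.witness (x j) := not_not.1 hj.2
    obtain ⟨a, ha⟩ := hsub j hp'
    obtain ⟨a', ha'⟩ := hsub i hq'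
    exact hcon ⟨h, a, a', ha, ha'⟩
  · rintro n F x ⟨i, hi⟩ ⟨j, hj⟩
    by_cases hn : n = 1
    · subst hn
      rw [Subsingleton.elim j i] at hj
      exact absurd hj.1 hi.2
    · exact (hF n hn).elim F

theorem emb_isFaithful [Finite A] (hF : ∀ n : ℕ, n ≠ 1 → IsEmpty (L.Functions n))
    (hW : W.IsConformal) : IsFaithfulEmb (W.emb hF) := by
  intro C _ hirr
  -- Conformality is applied to the union of all remembered closures, not just to the base vertices;
  -- otherwise second coordinates need not land in the copy.
  obtain ⟨k, hk, hkC⟩ := hW (⋃ p ∈ C, p.1.2) (by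
    intro b hb b' hb'
    simp only [Set.mem_iUnion, exists_prop] at hb hb'
    obtain ⟨p, hp, hb⟩ := hb
    obtain ⟨q, hq, hb'⟩ := hb'
    obtain ⟨h, a, a', rfl, rfl⟩ := W.exists_common_copy hF hirr hp hq
    refine ⟨h.1, h.2, ?_⟩
    rintro c (rfl | rfl)
    · obtain ⟨_, ⟨x, -, rfl⟩, rfl⟩ := hb
      exact ⟨x, rfl⟩
    · obtain ⟨_, ⟨x, -, rfl⟩, rfl⟩ := hb'
      exact ⟨x, rfl⟩)
  refine ⟨W.aut (⟨k, hk⟩ : W.H)⁻¹, ?_⟩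
  rintro _ ⟨p, hp, rfl⟩
  obtain ⟨l, a, rfl⟩ := W.exists_smul_point p
  obtain ⟨f, hf⟩ := W.exists_partialMap ((⟨k, hk⟩ : W.H)⁻¹ * l)
  refine ⟨f a, ?_⟩
  have key : ∀ x ∈ vertexClosure M a,
      ((⟨k, hk⟩ : W.H)⁻¹ * l).1.1 (W.ψ x) = W.ψ (f x) := by
    intro x hx
    obtain ⟨y, hy⟩ := hkC (l.1.1 (W.ψ x))
      (Set.mem_biUnion hp ⟨_, ⟨x, hx, rfl⟩, rfl⟩)
    have : ((⟨k, hk⟩ : W.H)⁻¹ * l).1.1 (W.ψ x) = W.ψ y := by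
      change k.1.symm (l.1.1 (W.ψ x)) = _
      rw [← hy, Equiv.symm_apply_apply]
    rw [hf x y this, this]
  have := W.smul_point_of_isSubstructure _ (isSubstructure_vertexClosure M a) f key
    (mem_vertexClosure_self M a)
  rw [mul_smul] at this
  exact this.symm

/-! ### Extension of partial automorphisms -/

variable [Finite A] (hF : ∀ n : ℕ, n ≠ 1 → IsEmpty (L.Functions n))

/-- The set of vertices of `A` corresponding to a set of vertices of the image of `A`. -/
def pullSet (S : Set (Set.range (W.emb hF).toFun)) : Set A := {a | ⟨W.point a, a, rfl⟩ ∈ S}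

/-- The correspondence between `pullSet S` and `S`. -/
noncomputable def pullEquiv (S : Set (Set.range (W.emb hF).toFun)) : W.pullSet hF S ≃ S :=
  (Equiv.ofInjective W.point W.point_injective).subtypeEquiv fun _ => Iff.rfl

theorem coe_pullEquiv (S : Set (Set.range (W.emb hF).toFun)) (a : W.pullSet hF S) :
    ((W.pullEquiv hF S a : Set.range (W.emb hF).toFun) : W.Point) = W.point a := rfl

/-- The bijection between subsets of `A` corresponding to a partial automorphism of the image. -/
noncomputable def pullMap (p : PartialAut Γ (W.emb hF).image) :
    W.pullSet hF p.dom ≃ W.pullSet hF p.ran :=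
  (W.pullEquiv hF p.dom).trans (p.iso.toEquiv.trans (W.pullEquiv hF p.ran).symm)

theorem point_pullMap (p : PartialAut Γ (W.emb hF).image) (a : W.pullSet hF p.dom) :
    W.point (W.pullMap hF p a) =
      ((p.iso.toEquiv (W.pullEquiv hF p.dom a) : Set.range (W.emb hF).toFun) : W.Point) := by
  rw [← W.coe_pullEquiv hF, pullMap]
  simp

theorem isSubstructure_pullSet {S : Set (Set.range (W.emb hF).toFun)}
    (hS : IsSubstructure (W.emb hF).image S) : IsSubstructure M (W.pullSet hF S) := by
  intro n F x hx c hc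
  refine hS n F (fun i => ⟨W.point (x i), x i, rfl⟩) hx ?_
  change W.point c ∈ W.witness.func n F (W.point ∘ x)
  rw [← W.image_point_func hF]
  exact ⟨c, hc, rfl⟩

theorem pullMap_preservesOn (p : PartialAut Γ (W.emb hF).image) (s : A → A)
    (hs : ∀ x : W.pullSet hF p.dom, s x = W.pullMap hF p x) :
    PreservesOn M (W.pullSet hF p.dom) s p.iso.lang := by
  have hD := W.isSubstructure_pullSet hF p.dom_sub
  have hE := W.isSubstructure_pullSet hF p.ran_sub
  have hcomp : ∀ (n : ℕ) (x : Fin n → A) (hx : ∀ i, x i ∈ W.pullSet hF p.dom),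
      (fun i => ((p.iso.toEquiv (W.pullEquiv hF p.dom ⟨x i, hx i⟩) :
        Set.range (W.emb hF).toFun) : W.Point)) = W.point ∘ s ∘ x := by
    intro n x hx
    funext i
    rw [← W.point_pullMap hF, ← hs]
    rfl
  have hfunc : ∀ (n : ℕ) (F : L.Functions n) (x : Fin n → A),
      (∀ i, x i ∈ W.pullSet hF p.dom) → ∀ y ∈ W.pullSet hF p.dom,
      (y ∈ M.func n F x ↔ s y ∈ M.func n ((p.iso.lang : LangPerm L).1 n F) (s ∘ x)) := by
    intro n F x hx y hy
    have h1 := p.iso.isEmbedding.map_func n F fun i => W.pullEquiv hF p.dom ⟨x i, hx i⟩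
    have h2 := Set.ext_iff.1 h1 (p.iso.toEquiv (W.pullEquiv hF p.dom ⟨y, hy⟩))
    rw [p.iso.toEquiv.injective.mem_set_image] at h2
    have h3 : W.point y ∈ W.witness.func n F (W.point ∘ x) ↔
        ((p.iso.toEquiv (W.pullEquiv hF p.dom ⟨y, hy⟩) : Set.range (W.emb hF).toFun) : W.Point) ∈
        W.witness.func n ((p.iso.lang : LangPerm L).1 n F) fun i =>
          ((p.iso.toEquiv (W.pullEquiv hF p.dom ⟨x i, hx i⟩) :
            Set.range (W.emb hF).toFun) : W.Point) := h2
    rw [hcomp n x hx, ← W.point_pullMap hF, ← hs, ← W.image_point_func hF,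
      ← W.image_point_func hF, W.point_injective.mem_set_image,
      W.point_injective.mem_set_image] at h3
    exact h3
  refine ⟨fun n R x hx => ?_, hfunc, fun n F x hx => ?_⟩
  · have h1 := p.iso.isEmbedding.map_rel n R fun i => W.pullEquiv hF p.dom ⟨x i, hx i⟩
    have h2 : W.point ∘ x ∈ W.witness.rel n R ↔ (fun i =>
        ((p.iso.toEquiv (W.pullEquiv hF p.dom ⟨x i, hx i⟩) :
          Set.range (W.emb hF).toFun) : W.Point)) ∈
          W.witness.rel n ((p.iso.lang : LangPerm L).2 n R) := h1
    rw [hcomp n x hx, ← W.point_mem_rel_iff, ← W.point_mem_rel_iff] at h2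
    exact h2
  -- Sizes agree because the range is a substructure: every function value at an image tuple lies in
  -- it and so has a preimage in the domain.
  · have hinj : Set.InjOn s (W.pullSet hF p.dom) := by
      intro y hy z hz e
      rw [hs ⟨y, hy⟩, hs ⟨z, hz⟩] at e
      exact congrArg Subtype.val ((W.pullMap hF p).injective (Subtype.ext e))
    have hsub := hD n F x hx
    rw [← (hinj.mono hsub).ncard_image]
    congr 1
    apply Set.Subset.antisymm
    · rintro _ ⟨c, hc, rfl⟩
      exact (hfunc n F x hx c (hsub hc)).1 hc
    · intro c hc
      have hcE := hE n _ (s ∘ x) (fun i => by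
        rw [Function.comp_apply, hs ⟨x i, hx i⟩]
        exact (W.pullMap hF p ⟨x i, hx i⟩).2) hc
      obtain ⟨⟨t, ht⟩, e⟩ := (W.pullMap hF p).surjective ⟨c, hcE⟩
      have e' : s t = c := by rw [hs ⟨t, ht⟩, e]
      subst e'
      exact ⟨t, (hfunc n F x hx t ht).2 hc, rfl⟩

/-- The extension of a partial automorphism, as an element of `Perm B × Γ`. -/
noncomputable def extension (p : PartialAut Γ (W.emb hF).image) : Perm B × Γ :=
  W.φ (W.pullSet hF p.dom) (W.pullSet hF p.ran) (W.pullMap hF p) p.iso.lang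

theorem extension_snd (p : PartialAut Γ (W.emb hF).image) :
    (W.extension hF p).2 = p.iso.lang := W.φ_snd _ _ _ _

theorem extension_mem (p : PartialAut Γ (W.emb hF).image) : W.extension hF p ∈ W.H :=
  W.φ_mem _ _ _ _ (extendPerm (W.pullMap hF p)) (extendPerm_apply _)
    (W.pullMap_preservesOn hF p _ (extendPerm_apply _))

theorem extension_apply (p : PartialAut Γ (W.emb hF).image) (a : W.pullSet hF p.dom) :
    (W.extension hF p).1 (W.ψ a) = W.ψ (W.pullMap hF p a) :=
  W.φ_apply _ _ _ _ (extendPerm (W.pullMap hF p)) (extendPerm_apply _)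
    (W.pullMap_preservesOn hF p _ (extendPerm_apply _)) a

theorem extension_comp {f g h : PartialAut Γ (W.emb hF).image} (H : IsCoherentTriple f g h) :
    W.extension hF h = W.extension hF g * W.extension hF f := by
  obtain ⟨D, E, hD, hE, ⟨γ, e, he⟩⟩ := f
  obtain ⟨E', F, hE', hF', ⟨δ, e', he'⟩⟩ := g
  obtain ⟨D', F', hD', hF'', ⟨ε, e'', he''⟩⟩ := h
  obtain ⟨h1, h2, h3, h4, h5⟩ := H
  simp only at h1 h2 h3
  subst h1 h2 h3
  simp only at h4
  subst h4
  have : e'' = e.trans e' := Equiv.ext fun x => Subtype.ext (h5 x)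
  subst this
  simp only [extension]
  rw [← W.φ_trans]
  congr 1
  ext x
  simp [pullMap]

theorem emb_isCoherentEPPA : IsCoherentEPPAEmb (W.emb hF) := by
  refine ⟨fun p => W.aut ⟨W.extension hF p, W.extension_mem hF p⟩, fun p => ⟨W.extension_snd hF p,
    ?_⟩, fun f g h H => ?_⟩
  · intro x
    obtain ⟨a, rfl⟩ := (W.pullEquiv hF p.dom).surjective x
    rw [← W.point_pullMap, ← extendPerm_apply]
    refine W.smul_point_of_isSubstructure _ (W.isSubstructure_pullSet hF p.dom_sub)
      (extendPerm (W.pullMap hF p)) (fun x hx => ?_) a.2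
    rw [extendPerm_apply _ ⟨x, hx⟩]
    exact W.extension_apply hF p ⟨x, hx⟩
  · have e : (⟨W.extension hF h, W.extension_mem hF h⟩ : W.H) =
        ⟨W.extension hF g, W.extension_mem hF g⟩ * ⟨W.extension hF f, W.extension_mem hF f⟩ :=
      Subtype.ext (W.extension_comp hF H)
    simp only [e]
    exact ⟨rfl, fun x => mul_smul (⟨W.extension hF g, W.extension_mem hF g⟩ : W.H)
      ⟨W.extension hF f, W.extension_mem hF f⟩ x⟩

end Amalgam

/-! ### Assembly of the witness -/

theorem exists_witness [Finite A] (hR : IsEmpty (L.Relations 0))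
    (hF : ∀ n : ℕ, n ≠ 1 → IsEmpty (L.Functions n)) (Γ : Subgroup (LangPerm L)) (M : Str L A)
    (hM : InFiniteOrbit Γ M) : ∃ (B : Type w) (_ : Finite B) (N : Str L B),
      IsFaithfulCoherentEPPAWitness Γ M N := by
  obtain ⟨B, hB, ⟨W⟩⟩ := exists_amalgam hR (hF 0 (by decide)) Γ M hM
  exact ⟨W.cover.Point, inferInstance, W.cover.witness, W.cover.emb hF,
    W.cover.emb_isCoherentEPPA hF, W.cover.emb_isFaithful hF W.cover_isConformal⟩

end GammaEPPA

theorem theorem1p1 (L : FirstOrder.Language.{u, v})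
    (hR : IsEmpty (L.Relations 0))
    (hF : ∀ n : ℕ, n ≠ 1 → IsEmpty (L.Functions n))
    (Γ : Subgroup (GammaEPPA.LangPerm L)) :
    (∀ (A : Type w) [Finite A] (M : GammaEPPA.Str L A), GammaEPPA.InFiniteOrbit Γ M →
      ∃ (B : Type w) (_ : Finite B) (N : GammaEPPA.Str L B),
        GammaEPPA.IsFaithfulCoherentEPPAWitness Γ M N) ∧
    ((∀ (A : Type w) [Finite A] (M : GammaEPPA.Str L A), GammaEPPA.InFiniteOrbit Γ M) →
      GammaEPPA.HasFaithfulCoherentEPPA Γ fun (A : Type w) (_ : GammaEPPA.Str L A) => Finite A) := by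
  refine ⟨fun A _ M hM => GammaEPPA.exists_witness hR hF Γ M hM, fun h A M hA => ?_⟩
  have : Finite A := hA
  obtain ⟨B, hB, N, hN⟩ := GammaEPPA.exists_witness hR hF Γ M (h A M)
  exact ⟨B, N, hB, hN⟩
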